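/- Let $m\ge 1$. For a Schwartz function $\psi$ on $\mathbb R$ let $(-\Delta)^{1/4}\psi$ be the function with Fourier transform $|\xi|^{1/2}\hat\psi$. Let $\dot H^{1/2}(\mathbb R)$ be the space of real functions $f\in L^1_{\rm loc}(\mathbb R)$ such that $f\,(-\Delta)^{1/4}\psi\in L^1(\mathbb R)$ for all Schwartz $\psi$ and such that there is $g=:(-\Delta)^{1/4}f\in L^2(\mathbb R)$ (unique a.e.) with $\int_{\mathbb R} f\,(-\Delta)^{1/4}\psi\,dx=\int_{\mathbb R} g\,\psi\,dx$ for all Schwartz $\psi$ (that is, $\widehat{(-\Delta)^{1/4}f}=|\xi|^{1/2}\hat f$). Let $\dot H^{1/2}(\mathbb R,\mathcal S^{m-1})$ be the set of maps $u=(u_1,\dots,u_m):\mathbb R\to\mathbb R^m$ with all $u_i\in\dot H^{1/2}(\mathbb R)$ and $|u(x)|=1$ for a.e. $x$. For $f,v\in\dot H^{1/2}(\mathbb R)$ put $\langle(-\Delta)^{1/2}f,v\rangle=\int_{\mathbb R}(-\Delta)^{1/4}f\,(-\Delta)^{1/4}v\,dx$, and for $u\in\dot H^{1/2}(\mathbb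 R,\mathcal S^{m-1})$ let $u\wedge(-\Delta)^{1/2}u$ be the distribution with components $$\varphi\mapsto\langle(-\Delta)^{1/2}u_j,\,u_i\varphi\rangle-\langle(-\Delta)^{1/2}u_i,\,u_j\varphi\rangle,\qquad \varphi\in C_c^\infty(\mathbb R),\quad 1\le i,j\le m.$$ **Proposition (singular point removability).** Let $u\in\dot H^{1/2}(\mathbb R,\mathcal S^{m-1})$ and let $\{a_1,\dots,a_\ell\}\subset\mathbb R$ be a finite set. Suppose that $u$ is a $1/2$-harmonic map in $\mathcal D'(\mathbb R\setminus\{a_1,\dots,a_\ell\})$, that is, $$u\wedge(-\Delta)^{1/2}u=0\quad\text{in }\mathcal D'(\mathbb R\setminus\{a_1,\dots,a_\ell\}).$$ Then $u_i\varphi\in\dot H^{1/2}(\mathbb R)$ for all $i$ and all $\varphi\in C_c^\infty(\mathbb R)$ (so that $u\wedge(-\Delta)^{1/2}u$ is well defined on all of $C_c^\infty(\mathbb R)$), and $$u\wedge(-\Delta)^{1/2}u=0\quad\text{in }\mathcal D'(\mathbb R).$$ -/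

import Mathlib

open MeasureTheory TopologicalSpace
open scoped FourierTransform SchwartzMap Distributions

noncomputable section

namespace HalfHarmonic

/-- The function `(-Δ)^{1/4} ψ` for a Schwartz function `ψ` on the line: the Fourier multiplier with
symbol `|ξ|^{1/2}` in the angular frequency, that is `(2π|ξ|)^{1/2}` in Mathlib's normalization
`𝓕 ψ ξ = ∫ exp (-2πi x ξ) ψ x dx`. -/
def quarterLaplacianSchwartz (ψ : 𝓢(ℝ, ℂ)) : ℝ → ℂ :=
  𝓕⁻ (fun ξ : ℝ => (((2 * Real.pi * |ξ|) ^ (1 / 2 : ℝ) : ℝ) : ℂ) * 𝓕 (ψ : ℝ → ℂ) ξ)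

/-- `g ∈ L²(ℝ)` is `(-Δ)^{1/4} f`, i.e. the Fourier transform of `g` is `|ξ|^{1/2}` times that of
`f`. As `f` need not be in `L²` (constants are allowed) and the symbol is not smooth at `0`, this is
expressed by transposition: `⟨f, (-Δ)^{1/4} ψ⟩ = ⟨g, ψ⟩` for all Schwartz functions `ψ`, where
the pairing on the left is required to converge absolutely. (Since `(-Δ)^{1/4} ψ` is
`O(|x|^{-3/2})` at infinity, it does so for every bounded measurable `f`.) -/
structure IsQuarterLaplacian (f g : ℝ → ℝ) : Prop where
  locallyIntegrable : LocallyIntegrable f volume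
  memLp : MemLp g 2 volume
  integrable : ∀ ψ : 𝓢(ℝ, ℂ),
    Integrable (fun x => (f x : ℂ) * quarterLaplacianSchwartz ψ x) volume
  integral_eq : ∀ ψ : 𝓢(ℝ, ℂ),
    ∫ x, (f x : ℂ) * quarterLaplacianSchwartz ψ x = ∫ x, (g x : ℂ) * ψ x

/-- The homogeneous space of real functions `f` on the line with `(-Δ)^{1/4} f ∈ L²(ℝ)`. -/
def MemHomHalf (f : ℝ → ℝ) : Prop := ∃ g : ℝ → ℝ, IsQuarterLaplacian f g

open Classical in
/-- A representative of the (almost everywhere unique) function `(-Δ)^{1/4} f ∈ L²(ℝ)`, for `f` in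
the homogeneous space of order `1/2`; the value is `0` for other `f`. -/
def quarterLaplacian (f : ℝ → ℝ) : ℝ → ℝ :=
  if h : MemHomHalf f then h.choose else 0

/-- Maps of finite energy from the line to the unit sphere of `ℝᵐ`. -/
structure MemHomHalfSphere {m : ℕ} (u : ℝ → EuclideanSpace ℝ (Fin m)) : Prop where
  memHomHalf : ∀ i, MemHomHalf (fun x => u x i)
  mem_sphere : ∀ᵐ x, u x ∈ Metric.sphere (0 : EuclideanSpace ℝ (Fin m)) 1

/-- The distribution `(-Δ)^{1/2} f`, for `f` in the homogeneous space of order `1/2`, as a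
functional on functions `v` of that same space:
`⟨(-Δ)^{1/2} f, v⟩ = ∫ (-Δ)^{1/4} f (-Δ)^{1/4} v`. -/
def halfLaplacian (f v : ℝ → ℝ) : ℝ :=
  ∫ x, quarterLaplacian f x * quarterLaplacian v x

/-- The component `(i, j)` of `u ∧ (-Δ)^{1/2} u`, that is
`u_i (-Δ)^{1/2} u_j - u_j (-Δ)^{1/2} u_i`, evaluated at a test function `φ`. The product of the
function `u_i` with the distribution `(-Δ)^{1/2} u_j` is `φ ↦ ⟨(-Δ)^{1/2} u_j, u_i φ⟩`. -/
def wedgeHalfLaplacian {m : ℕ} (u : ℝ → EuclideanSpace ℝ (Fin m)) (i j : Fin m)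
    (φ : ℝ → ℝ) : ℝ :=
  halfLaplacian (fun x => u x j) (fun x => u x i * φ x) -
    halfLaplacian (fun x => u x i) (fun x => u x j * φ x)

/-- `u ∧ (-Δ)^{1/2} u = 0` in the sense of distributions on the open set `Ω`. -/
def IsHalfHarmonicOn {m : ℕ} (u : ℝ → EuclideanSpace ℝ (Fin m)) (Ω : Opens ℝ) : Prop :=
  ∀ φ : 𝓓(Ω, ℝ), ∀ i j : Fin m, wedgeHalfLaplacian u i j φ = 0

/-- The line with finitely many points removed. -/
def puncturedLine (A : Finset ℝ) : Opens ℝ :=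
  ⟨(A : Set ℝ)ᶜ, A.finite_toSet.isClosed.isOpen_compl⟩

end HalfHarmonic

end

namespace HalfHarmonic

open Filter Topology
open scoped ENNReal ContDiff ComplexConjugate

/-! Points are removable because they are invisible to weak convergence in the energy space. A test
function `φ` is multiplied by a product `ρₙ` of cutoffs `1 - κ ((n + 1) (x - a))`, which vanishes
near every `a ∈ A`. The order-1/2 seminorm on the line is invariant under dilation, so `u_i φ ρₙ`
stays bounded in energy, and `ρₙ → 1` a.e. Hence the quarter Laplacians of `u_i φ ρₙ` converge
weakly in `L²` to that of `u_i φ`. Weak convergence is enough, since the wedge pairs them with the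
fixed functions `(-Δ)^{1/4} u_j`: the equation for `φ ρₙ` passes to `φ`
(`exists_testFunction_approx`).

Products are controlled through the Gagliardo seminorm, where the product rule is elementary for
bounded factors (`gagliardo_mul_le`); the sphere constraint supplies `|u_i| ≤ 1`. Two bridges to the
Fourier definition are needed. For integrable `L²` functions, Plancherel turns a finite seminorm
into a quarter Laplacian (`exists_isQuarterLaplacian`). For `u_i` itself, merely bounded, the
transposed definition must give a finite seminorm (`IsQuarterLaplacian.gagliardo_ne_top`). This is
the delicate direction: it works with differences `f (· + h) - f`, whose symbol vanishes at `0` and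
compensates the singularity of `|ξ|^{-1/2}`. -/

/-! ### Plancherel and duality for the Fourier transform -/

lemma eLpNorm_two_sq {f : ℝ → ℂ} : eLpNorm f 2 volume ^ 2 = ∫⁻ x, ‖f x‖ₑ ^ 2 := by
  have := eLpNorm_nnreal_pow_eq_lintegral (μ := volume) (f := f) (p := 2) (by norm_num)
  simpa using this

lemma enorm_Lp_sq (G : Lp ℂ 2 (volume : Measure ℝ)) : ‖G‖ₑ ^ 2 = ∫⁻ x, ‖G x‖ₑ ^ 2 := by
  rw [Lp.enorm_def, eLpNorm_two_sq]

lemma integral_fourier_Lp_mul (G : Lp ℂ 2 (volume : Measure ℝ)) (q : 𝓢(ℝ, ℂ)) :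
    ∫ x, (𝓕 G : Lp ℂ 2 (volume : Measure ℝ)) x * q x = ∫ x, G x * 𝓕 (q : ℝ → ℂ) x := by
  have h := congrArg (fun T : 𝓢'(ℝ, ℂ) => T q) (Lp.fourier_toTemperedDistribution_eq G)
  simp only [TemperedDistribution.fourier_apply, Lp.toTemperedDistribution_apply,
    smul_eq_mul] at h
  simp only [mul_comm _ (q _)]
  rw [← h]
  simp only [mul_comm (G _)]
  rfl

lemma ae_eq_of_integral_mul_schwartz {F F' : ℝ → ℂ} (hF : LocallyIntegrable F)
    (hF' : LocallyIntegrable F') (h : ∀ q : 𝓢(ℝ, ℂ), ∫ x, F x * q x = ∫ x, F' x * q x) :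
    F =ᵐ[volume] F' := by
  refine ae_eq_of_integral_contDiff_smul_eq hF hF' fun g hg hc => ?_
  have hc' : HasCompactSupport (fun x => (g x : ℂ)) := hc.comp_left (g := Complex.ofReal) (by simp)
  have := h (hc'.toSchwartzMap (Complex.ofRealCLM.contDiff.comp hg))
  simp only [Complex.real_smul, mul_comm (Complex.ofReal _)]
  exact this

lemma integral_fourier_mul_swap {f w : ℝ → ℂ} (hf : Integrable f) (hw : Integrable w) :
    ∫ ξ, 𝓕 f ξ * w ξ = ∫ x, f x * 𝓕 w x := by
  simpa using! VectorFourier.integral_bilin_fourierIntegral_eq_flip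
    (ContinuousLinearMap.mul ℂ ℂ) (L := innerₗ ℝ)
    Real.continuous_fourierChar continuous_inner hf hw

lemma continuous_fourier {f : ℝ → ℂ} (hf : Integrable f) : Continuous (𝓕 f) :=
  VectorFourier.fourierIntegral_continuous Real.continuous_fourierChar
    (innerSL ℝ).continuous₂ hf

lemma fourier_toLp_ae {f : ℝ → ℂ} (hf : Integrable f) (hf2 : MemLp f 2) :
    (𝓕 (hf2.toLp f) : Lp ℂ 2 (volume : Measure ℝ)) =ᵐ[volume] 𝓕 f := by
  refine ae_eq_of_integral_mul_schwartz ((Lp.memLp _).locallyIntegrable (by norm_num))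
    (continuous_fourier hf).locallyIntegrable fun q => ?_
  rw [integral_fourier_Lp_mul, integral_fourier_mul_swap hf q.integrable]
  refine integral_congr_ae ?_
  filter_upwards [hf2.coeFn_toLp] with x hx
  rw [hx]

lemma lintegral_fourier_sq {f : ℝ → ℂ} (hf : Integrable f) (hf2 : MemLp f 2) :
    ∫⁻ ξ, ‖𝓕 f ξ‖ₑ ^ 2 = ∫⁻ x, ‖f x‖ₑ ^ 2 := by
  have h1 : ‖(𝓕 (hf2.toLp f) : Lp ℂ 2 (volume : Measure ℝ))‖ₑ = ‖hf2.toLp f‖ₑ := by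
    simp only [← ofReal_norm, Lp.norm_fourier_eq]
  have h2 := congrArg (· ^ 2) h1
  simp only [enorm_Lp_sq] at h2
  have h3 := lintegral_congr_ae ((fourier_toLp_ae hf hf2).fun_comp fun z => ‖z‖ₑ ^ 2)
  have h4 := lintegral_congr_ae (hf2.coeFn_toLp.fun_comp fun z => ‖z‖ₑ ^ 2)
  exact h3.symm.trans (h2.trans h4)

/-! ### Difference operators on the Fourier side -/

/-- The symbol of the difference operator `f ↦ f (· + h) - f`. -/
noncomputable def diffSymbol (h ξ : ℝ) : ℂ :=
  Complex.exp (((2 * Real.pi * (h * ξ) : ℝ) : ℂ) * Complex.I) - 1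

lemma diffSymbol_eq (h ξ : ℝ) : diffSymbol h ξ = (Real.fourierChar (h * ξ) : ℂ) - 1 := by
  rw [diffSymbol, Real.fourierChar_apply]

lemma continuous_diffSymbol : Continuous (fun p : ℝ × ℝ => diffSymbol p.1 p.2) := by
  unfold diffSymbol; fun_prop

lemma norm_diffSymbol_le_two (h ξ : ℝ) : ‖diffSymbol h ξ‖ ≤ 2 := by
  refine (norm_sub_le _ _).trans ?_
  rw [Complex.norm_exp_ofReal_mul_I]; norm_num

lemma norm_diffSymbol_le (h ξ : ℝ) : ‖diffSymbol h ξ‖ ≤ 2 * Real.pi * (|h| * |ξ|) := by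
  have := Real.norm_exp_I_mul_ofReal_sub_one_le (x := 2 * Real.pi * (h * ξ))
  rw [diffSymbol, mul_comm _ Complex.I]
  refine this.trans (le_of_eq ?_)
  rw [Real.norm_eq_abs, abs_mul, abs_mul h, abs_of_pos Real.two_pi_pos]

lemma fourier_comp_add_sub {f : ℝ → ℂ} (hf : Integrable f) (h ξ : ℝ) :
    𝓕 (fun x => f (x + h) - f x) ξ = diffSymbol h ξ * 𝓕 f ξ := by
  have h1 := congrFun (VectorFourier.fourierIntegral_comp_add_right Real.fourierChar volume
    (innerₗ ℝ) f h) ξ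
  have h2 : 𝓕 (fun x => f (x + h) - f x) ξ = 𝓕 (f ∘ fun x => x + h) ξ - 𝓕 f ξ := by
    simp only [Real.fourier_eq]
    rw [← integral_sub]
    · simp [smul_sub]
    · exact (Real.fourierIntegral_convergent_iff ξ).2 (hf.comp_add_right h)
    · exact (Real.fourierIntegral_convergent_iff ξ).2 hf
  rw [h2]
  change VectorFourier.fourierIntegral _ _ _ _ _ - _ = _
  rw [h1, diffSymbol_eq, sub_mul, one_mul, Circle.smul_def, smul_eq_mul]
  simp only [innerₗ_apply_apply, RCLike.inner_apply, conj_trivial]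
  rw [mul_comm ξ h]; rfl

lemma fourier_diffSymbol_mul {q : ℝ → ℂ} (hq : Integrable q) (h x : ℝ) :
    𝓕 (fun ξ => diffSymbol h ξ * q ξ) x = 𝓕 q (x - h) - 𝓕 q x := by
  simp only [Real.fourier_real_eq]
  rw [← integral_sub]
  · congr 1 with ξ
    simp only [diffSymbol_eq, Circle.smul_def, smul_eq_mul]
    rw [show -(ξ * (x - h)) = h * ξ + -(ξ * x) by ring, AddChar.map_add_eq_mul, Circle.coe_mul]
    ring
  · simpa [mul_comm] using (Real.fourierIntegral_convergent_iff (x - h)).2 hq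
  · simpa [mul_comm] using (Real.fourierIntegral_convergent_iff x).2 hq

lemma lintegral_eq_mul_lintegral_comp_mul_left (φ : ℝ → ℝ≥0∞) {a : ℝ} (ha : a ≠ 0) :
    ∫⁻ x, φ x = ‖a‖ₑ * ∫⁻ x, φ (a * x) := by
  have := (Homeomorph.mulLeft₀ a ha).measurableEmbedding.lintegral_map (μ := volume) φ
  simp only [Homeomorph.coe_mulLeft₀] at this
  conv_lhs => rw [← Real.smul_map_volume_mul_left ha]
  rw [lintegral_smul_measure, this, smul_eq_mul, Real.enorm_eq_ofReal_abs]

/-- The constant `∫ |exp (2πit) - 1|² / t² dt`. -/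
noncomputable def kernelConst : ℝ≥0∞ := ∫⁻ t : ℝ, ‖diffSymbol t 1‖ₑ ^ 2 / ‖t‖ₑ ^ 2

lemma measurable_diffSymbol_left (ξ : ℝ) : Measurable (fun h => diffSymbol h ξ) :=
  (continuous_diffSymbol.comp (by fun_prop : Continuous fun h : ℝ => (h, ξ))).measurable

lemma measurable_diffSymbol_right (h : ℝ) : Measurable (fun ξ => diffSymbol h ξ) :=
  (continuous_diffSymbol.comp (by fun_prop : Continuous fun ξ : ℝ => (h, ξ))).measurable

lemma kernelConst_ne_top : kernelConst ≠ ⊤ := by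
  -- The bounds `4` and `4π²t²` on the squared symbol combine to `(4π² + 4) / (1 + t²)` for the
  -- quotient.
  refine ne_top_of_le_ne_top (integrable_inv_one_add_sq.const_mul
    (4 * Real.pi ^ 2 + 4)).lintegral_lt_top.ne (lintegral_mono_ae ?_)
  have h0 : ∀ᵐ t : ℝ, t ≠ 0 := by simp [ae_iff]
  filter_upwards [h0] with t ht
  have e1 : ‖diffSymbol t 1‖ₑ ^ 2 / ‖t‖ₑ ^ 2
      = ENNReal.ofReal (‖diffSymbol t 1‖ ^ 2 / |t| ^ 2) := by
    rw [ENNReal.ofReal_div_of_pos (by positivity), ENNReal.ofReal_pow (norm_nonneg _),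
      ENNReal.ofReal_pow (abs_nonneg _), ofReal_norm, Real.enorm_eq_ofReal_abs]
  rw [e1]
  refine ENNReal.ofReal_le_ofReal ?_
  have h1 := norm_diffSymbol_le_two t 1
  have h2 := norm_diffSymbol_le t 1
  rw [abs_one, mul_one] at h2
  have h3 : ‖diffSymbol t 1‖ ^ 2 ≤ 2 ^ 2 := by gcongr
  have h4 : ‖diffSymbol t 1‖ ^ 2 ≤ (2 * Real.pi * |t|) ^ 2 := by gcongr
  rw [mul_pow, sq_abs] at h4
  have h5 : 0 < t ^ 2 := by positivity
  rw [sq_abs, ← div_eq_mul_inv, div_le_div_iff₀ h5 (by positivity)]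
  nlinarith

lemma kernelConst_ne_zero : kernelConst ≠ 0 := by
  intro h
  have hm : Measurable fun t : ℝ => ‖diffSymbol t 1‖ₑ ^ 2 / ‖t‖ₑ ^ 2 :=
    ((measurable_diffSymbol_left 1).enorm.pow_const 2).div (measurable_enorm.pow_const 2)
  rw [kernelConst, lintegral_eq_zero_iff hm] at h
  have h1 : (fun t => diffSymbol t 1) =ᵐ[volume] fun _ => (0 : ℂ) := by
    filter_upwards [h] with t ht
    simpa using ht
  have h2 := (Continuous.ae_eq_iff_eq volume
    (continuous_diffSymbol.comp (by fun_prop : Continuous fun h : ℝ => (h, (1 : ℝ))))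
    continuous_const).1 h1
  -- At `t = 1/2` the symbol equals `exp (πi) - 1 = -2`.
  have h3 := congrFun h2 (1 / 2)
  have h4 : ((2 * Real.pi * (1 / 2 * 1) : ℝ) : ℂ) * Complex.I = Real.pi * Complex.I := by
    push_cast; ring
  simp only [Function.comp_apply, diffSymbol, h4, Complex.exp_pi_mul_I] at h3
  norm_num at h3

/-- The symbol depends only on `hξ`, so substituting `t = ξh` extracts one factor `|ξ|`. -/
lemma lintegral_diffSymbol_div (ξ : ℝ) :
    ∫⁻ h : ℝ, ‖diffSymbol h ξ‖ₑ ^ 2 / ‖h‖ₑ ^ 2 = kernelConst * ‖ξ‖ₑ := by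
  rcases eq_or_ne ξ 0 with rfl | hξ
  · simp [diffSymbol]
  have key : ∀ h : ℝ, ‖diffSymbol h ξ‖ₑ ^ 2 / ‖h‖ₑ ^ 2
      = ‖ξ‖ₑ ^ 2 * (‖diffSymbol (ξ * h) 1‖ₑ ^ 2 / ‖ξ * h‖ₑ ^ 2) := by
    intro h
    have e : diffSymbol (ξ * h) 1 = diffSymbol h ξ := by
      simp only [diffSymbol, mul_one, mul_comm ξ h]
    rw [e, enorm_mul, mul_pow, ← mul_div_assoc, ENNReal.mul_div_mul_left _ _ (by simpa using hξ)
      (by finiteness)]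
  simp only [key]
  rw [lintegral_const_mul' _ _ (by finiteness), kernelConst,
    lintegral_eq_mul_lintegral_comp_mul_left (fun t => ‖diffSymbol t 1‖ₑ ^ 2 / ‖t‖ₑ ^ 2) hξ]
  ring

lemma lintegral_lintegral_diffSymbol {F : ℝ → ℝ≥0∞} (hF : AEMeasurable F) :
    ∫⁻ h : ℝ, (∫⁻ ξ, ‖diffSymbol h ξ‖ₑ ^ 2 * F ξ) / ‖h‖ₑ ^ 2
      = kernelConst * ∫⁻ ξ, ‖ξ‖ₑ * F ξ := by
  wlog hm : Measurable F generalizing F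
  · have := this hF.measurable_mk.aemeasurable hF.measurable_mk
    have e1 : ∀ h : ℝ, ∫⁻ ξ, ‖diffSymbol h ξ‖ₑ ^ 2 * hF.mk F ξ
        = ∫⁻ ξ, ‖diffSymbol h ξ‖ₑ ^ 2 * F ξ := fun h =>
      lintegral_congr_ae (hF.ae_eq_mk.mono fun x hx => by simp only [hx])
    have e2 : ∫⁻ ξ, ‖ξ‖ₑ * hF.mk F ξ = ∫⁻ ξ, ‖ξ‖ₑ * F ξ :=
      lintegral_congr_ae (hF.ae_eq_mk.mono fun x hx => by simp only [hx])
    simpa only [e1, e2] using this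
  have hd : Measurable (fun p : ℝ × ℝ => ‖diffSymbol p.1 p.2‖ₑ ^ 2) :=
    continuous_diffSymbol.measurable.enorm.pow_const 2
  calc _ = ∫⁻ h : ℝ, ∫⁻ ξ, ‖diffSymbol h ξ‖ₑ ^ 2 * F ξ / ‖h‖ₑ ^ 2 := by
        refine lintegral_congr fun h => ?_
        simp only [div_eq_mul_inv]
        rw [lintegral_mul_const]
        exact ((measurable_diffSymbol_right h).enorm.pow_const 2).mul hm
    _ = ∫⁻ ξ, ∫⁻ h : ℝ, ‖diffSymbol h ξ‖ₑ ^ 2 * F ξ / ‖h‖ₑ ^ 2 := by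
        refine lintegral_lintegral_swap (Measurable.aemeasurable ?_)
        exact ((hd.mul (hm.comp measurable_snd)).div
          ((measurable_enorm.comp measurable_fst).pow_const 2))
    _ = ∫⁻ ξ, kernelConst * (‖ξ‖ₑ * F ξ) := by
        refine lintegral_congr fun ξ => ?_
        rw [← mul_assoc, ← lintegral_diffSymbol_div, ← lintegral_mul_const]
        · simp only [div_eq_mul_inv, mul_right_comm]
        · exact ((measurable_diffSymbol_left ξ).enorm.pow_const 2).div
            (measurable_enorm.pow_const 2)
    _ = _ := lintegral_const_mul _ (measurable_enorm.mul hm)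

/-! ### The Gagliardo seminorm and the symbol `|ξ|^{1/2}` -/

/-- The squared Gagliardo seminorm of order `1/2` on the line. -/
noncomputable def gagliardo (f : ℝ → ℝ) : ℝ≥0∞ :=
  ∫⁻ h : ℝ, (∫⁻ x, ‖f (x + h) - f x‖ₑ ^ 2) / ‖h‖ₑ ^ 2

lemma enorm_ofReal_eq (x : ℝ) : ‖(x : ℂ)‖ₑ = ‖x‖ₑ := by
  rw [← ofReal_norm, ← ofReal_norm, Complex.norm_real]

/-- Plancherel applies to each difference `f (· + h) - f`; Tonelli then integrates the symbol
against `dh / h²`. -/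
lemma gagliardo_eq_fourier {f : ℝ → ℝ} (hf : Integrable f) (hf2 : MemLp f 2) :
    gagliardo f = kernelConst * ∫⁻ ξ, ‖ξ‖ₑ * ‖𝓕 (fun x => (f x : ℂ)) ξ‖ₑ ^ 2 := by
  have hc : Integrable (fun x => (f x : ℂ)) := hf.ofReal
  have hc2 : MemLp (fun x => (f x : ℂ)) 2 := hf2.ofReal
  rw [← lintegral_lintegral_diffSymbol ((continuous_fourier hc).measurable.enorm.pow_const
    2).aemeasurable, gagliardo]
  congr 1 with h
  congr 1
  have h1 : Integrable (fun x => (f (x + h) : ℂ) - f x) := (hc.comp_add_right h).sub hc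
  have h2 : MemLp (fun x => (f (x + h) : ℂ) - f x) 2 :=
    (hc2.comp_measurePreserving (measurePreserving_add_right volume h)).sub hc2
  have := lintegral_fourier_sq h1 h2
  simp only [fourier_comp_add_sub hc, enorm_mul, mul_pow] at this
  rw [this]
  simp only [← Complex.ofReal_sub, enorm_ofReal_eq]

/-- The symbol of `(-Δ)^{1/4}`. -/
noncomputable def quarterSymbol (ξ : ℝ) : ℝ := (2 * Real.pi * |ξ|) ^ (1 / 2 : ℝ)

lemma quarterSymbol_nonneg (ξ : ℝ) : 0 ≤ quarterSymbol ξ := by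
  unfold quarterSymbol; positivity

lemma continuous_quarterSymbol : Continuous quarterSymbol := by
  unfold quarterSymbol
  exact Continuous.rpow_const (by fun_prop) fun _ => Or.inr (by norm_num)

lemma quarterSymbol_sq (ξ : ℝ) : quarterSymbol ξ ^ 2 = 2 * Real.pi * |ξ| := by
  rw [quarterSymbol, ← Real.rpow_natCast, ← Real.rpow_mul (by positivity)]
  norm_num

lemma quarterSymbol_pos {ξ : ℝ} (hξ : ξ ≠ 0) : 0 < quarterSymbol ξ := by
  unfold quarterSymbol; positivity

lemma quarterSymbol_le (ξ : ℝ) : quarterSymbol ξ ≤ 1 + 2 * Real.pi * |ξ| := by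
  have := quarterSymbol_sq ξ
  nlinarith [sq_nonneg (quarterSymbol ξ - 1)]

lemma enorm_quarterSymbol_sq (ξ : ℝ) :
    ‖quarterSymbol ξ‖ₑ ^ 2 = ENNReal.ofReal (2 * Real.pi) * ‖ξ‖ₑ := by
  rw [← enorm_pow, quarterSymbol_sq, enorm_mul, Real.enorm_abs,
    Real.enorm_of_nonneg Real.two_pi_pos.le]

lemma integrable_quarterSymbol_mul (q : 𝓢(ℝ, ℂ)) :
    Integrable (fun ξ => (quarterSymbol ξ : ℂ) * q ξ) := by
  have h1 := q.integrable.norm.add ((q.integrable_pow_mul volume 1).const_mul (2 * Real.pi))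
  refine h1.mono' ((Complex.continuous_ofReal.comp
    continuous_quarterSymbol).mul q.continuous).aestronglyMeasurable (ae_of_all _ fun ξ => ?_)
  rw [norm_mul, Complex.norm_real, Real.norm_of_nonneg (quarterSymbol_nonneg ξ)]
  have := mul_le_mul_of_nonneg_right (quarterSymbol_le ξ) (norm_nonneg (q ξ))
  simp only [Pi.add_apply, pow_one, Real.norm_eq_abs]
  linarith

lemma quarterLaplacianSchwartz_eq (ψ : 𝓢(ℝ, ℂ)) :
    quarterLaplacianSchwartz ψ = 𝓕 (fun ξ => (quarterSymbol ξ : ℂ) * (𝓕⁻ ψ : 𝓢(ℝ, ℂ)) ξ) := by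
  rw [quarterLaplacianSchwartz, Real.fourierInv_eq_fourier_comp_neg]
  congr 1 with ξ
  rw [SchwartzMap.fourierInv_coe, Real.fourierInv_eq_fourier_neg, quarterSymbol, abs_neg]

lemma continuous_quarterLaplacianSchwartz (ψ : 𝓢(ℝ, ℂ)) :
    Continuous (quarterLaplacianSchwartz ψ) := by
  rw [quarterLaplacianSchwartz_eq]
  exact continuous_fourier (integrable_quarterSymbol_mul _)

lemma norm_quarterLaplacianSchwartz_le (ψ : 𝓢(ℝ, ℂ)) :
    ∃ C, ∀ x, ‖quarterLaplacianSchwartz ψ x‖ ≤ C := by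
  rw [quarterLaplacianSchwartz_eq]
  exact ⟨_, fun x => VectorFourier.norm_fourierIntegral_le_integral_norm _ _ _ _ x⟩

lemma conj_fourier (w : ℝ → ℂ) (x : ℝ) : conj (𝓕 w x) = 𝓕⁻ (fun ξ => conj (w ξ)) x := by
  rw [Real.fourier_eq', Real.fourierInv_eq', ← integral_conj]
  congr 1 with ξ
  simp only [smul_eq_mul, map_mul, ← Complex.exp_conj, Complex.conj_ofReal, Complex.conj_I]
  congr 2
  push_cast
  ring

lemma conj_fourierInv (w : ℝ → ℂ) (x : ℝ) : conj (𝓕⁻ w x) = 𝓕 (fun ξ => conj (w ξ)) x := by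
  rw [Real.fourierInv_eq_fourier_neg, conj_fourier, Real.fourierInv_eq_fourier_neg, neg_neg]

/-- The multiplier is real and even, so it preserves real functions. -/
lemma conj_quarterLaplacianSchwartz {ψ : 𝓢(ℝ, ℂ)} (hψ : ∀ x, conj (ψ x) = ψ x) (x : ℝ) :
    conj (quarterLaplacianSchwartz ψ x) = quarterLaplacianSchwartz ψ x := by
  rw [quarterLaplacianSchwartz, conj_fourierInv, Real.fourierInv_eq_fourier_comp_neg]
  refine congrFun (congrArg 𝓕 (funext fun ξ => ?_)) x
  rw [map_mul, Complex.conj_ofReal, conj_fourier, abs_neg, Real.fourierInv_eq_fourier_neg]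
  simp only [hψ]

/-- The candidate is the inverse `L²` Fourier transform of `quarterSymbol · 𝓕 f`, which is square
integrable exactly because the seminorm is finite. -/
lemma exists_isQuarterLaplacian {f : ℝ → ℝ} (hf : Integrable f) (hf2 : MemLp f 2)
    (hfin : gagliardo f ≠ ⊤) :
    ∃ g, IsQuarterLaplacian f g ∧
      kernelConst * ∫⁻ x, ‖g x‖ₑ ^ 2 ≤ ENNReal.ofReal (2 * Real.pi) * gagliardo f := by
  have hc : Integrable (fun x => (f x : ℂ)) := hf.ofReal
  set N : ℝ → ℂ := fun ξ => (quarterSymbol ξ : ℂ) * 𝓕 (fun x => (f x : ℂ)) ξ with hN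
  have hNc : Continuous N :=
    (Complex.continuous_ofReal.comp continuous_quarterSymbol).mul (continuous_fourier hc)
  have hNint : kernelConst * ∫⁻ ξ, ‖N ξ‖ₑ ^ 2 = ENNReal.ofReal (2 * Real.pi) * gagliardo f := by
    simp only [hN, enorm_mul, mul_pow, enorm_ofReal_eq, enorm_quarterSymbol_sq, mul_assoc]
    rw [lintegral_const_mul' _ _ ENNReal.ofReal_ne_top, gagliardo_eq_fourier hf hf2]
    ring
  have hN2 : MemLp N 2 := by
    refine ⟨hNc.aestronglyMeasurable, ?_⟩
    have h1 : ∫⁻ ξ, ‖N ξ‖ₑ ^ 2 < ⊤ := by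
      have : kernelConst * ∫⁻ ξ, ‖N ξ‖ₑ ^ 2 ≠ ⊤ := by rw [hNint]; finiteness
      exact (ENNReal.lt_top_of_mul_ne_top_right this kernelConst_ne_zero)
    rw [← eLpNorm_two_sq] at h1
    exact lt_top_iff_ne_top.2 fun h => by simp [h] at h1
  set G : Lp ℂ 2 (volume : Measure ℝ) := 𝓕⁻ (hN2.toLp N) with hG
  have hFG : (𝓕 G : Lp ℂ 2 (volume : Measure ℝ)) =ᵐ[volume] N := by
    rw [hG, FourierTransform.fourier_fourierInv_eq]
    exact hN2.coeFn_toLp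
  have hpair : ∀ ψ : 𝓢(ℝ, ℂ), ∫ x, (f x : ℂ) * quarterLaplacianSchwartz ψ x = ∫ x, G x * ψ x := by
    intro ψ
    rw [quarterLaplacianSchwartz_eq, ← integral_fourier_mul_swap hc
      (integrable_quarterSymbol_mul _)]
    have h1 := integral_fourier_Lp_mul G (𝓕⁻ ψ)
    rw [← SchwartzMap.fourier_coe, FourierTransform.fourier_fourierInv_eq ψ] at h1
    rw [← h1]
    refine integral_congr_ae (hFG.mono fun ξ hξ => ?_)
    simp only [hξ, hN]
    ring
  have hGloc : LocallyIntegrable G := (Lp.memLp G).locallyIntegrable (by norm_num)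
  -- Tested against real `χ`, `G` pairs as `f` with the real function `(-Δ)^{1/4} χ`, so its
  -- imaginary part is orthogonal to all test functions.
  have hreal : ∀ᵐ x, (G x).im = 0 := by
    refine ae_eq_zero_of_integral_contDiff_smul_eq_zero ?_ fun χ hχ hχc => ?_
    · intro x
      obtain ⟨s, hs, hi⟩ := hGloc x
      exact ⟨s, hs, hi.im⟩
    have hc' : HasCompactSupport (fun x => (χ x : ℂ)) :=
      hχc.comp_left (g := Complex.ofReal) (by simp)
    set ψ := hc'.toSchwartzMap (Complex.ofRealCLM.contDiff.comp hχ)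
    have hψ : ∀ x, ψ x = (χ x : ℂ) := fun x => rfl
    have h1 : ∫ x, χ x • (G x).im = (∫ x, G x * ψ x).im := by
      have hi : Integrable fun x => G x * ψ x := (Lp.memLp G).integrable_mul (ψ.memLp 2)
      have := integral_im hi
      simp only [RCLike.im_to_complex] at this
      rw [← this]
      congr 1 with x
      simp [hψ, mul_comm]
    rw [h1, ← hpair, ← Complex.conj_eq_iff_im, ← integral_conj]
    congr 1 with x
    rw [map_mul, Complex.conj_ofReal, conj_quarterLaplacianSchwartz]
    intro x; rw [hψ, Complex.conj_ofReal]
  have hre : ∀ᵐ x, (((G x).re : ℝ) : ℂ) = G x := by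
    filter_upwards [hreal] with x hx
    exact Complex.ext rfl (by simp [hx])
  refine ⟨fun x => (G x).re, ⟨hf.locallyIntegrable, (Lp.memLp G).re, fun ψ => ?_, fun ψ => ?_⟩, ?_⟩
  · obtain ⟨C, hC⟩ := norm_quarterLaplacianSchwartz_le ψ
    exact hc.mul_bdd (c := C) (continuous_quarterLaplacianSchwartz ψ).aestronglyMeasurable
      (ae_of_all _ hC)
  · rw [hpair]
    exact integral_congr_ae (hre.mono fun x hx => by simp only [hx])
  · rw [← hNint]
    refine mul_le_mul_right (le_of_eq ?_) _
    have h1 : ‖G‖ₑ = ‖hN2.toLp N‖ₑ := by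
      rw [← ofReal_norm, ← ofReal_norm, hG]
      congr 1
      rw [← Lp.norm_fourier_eq, FourierTransform.fourier_fourierInv_eq]
    have h2 := congrArg (· ^ 2) h1
    simp only [enorm_Lp_sq] at h2
    refine Eq.trans ?_ (h2.trans
      (lintegral_congr_ae (hN2.coeFn_toLp.fun_comp fun z => ‖z‖ₑ ^ 2)))
    refine lintegral_congr_ae (hre.mono fun x hx => ?_)
    simp only
    rw [← enorm_ofReal_eq, hx]

/-! ### From the transposed definition to a finite Gagliardo seminorm -/

/-- Cauchy–Schwarz with weight `√(1 + x²)`, then Plancherel for `w` and `w'`. A merely bounded `f`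
can only be paired with `L¹` limits of Fourier transforms, and this controls them by `H¹` norms. -/
lemma lintegral_fourier_schwartz_sq_le (w : 𝓢(ℝ, ℂ)) :
    (∫⁻ x, ‖𝓕 (w : ℝ → ℂ) x‖ₑ) ^ 2 ≤ (∫⁻ x : ℝ, ENNReal.ofReal (1 + x ^ 2)⁻¹) *
      ((∫⁻ x, ‖w x‖ₑ ^ 2) + ∫⁻ x, ‖deriv w x‖ₑ ^ 2) := by
  set a : ℝ → ℝ≥0∞ := fun x => ENNReal.ofReal (√(1 + x ^ 2))⁻¹
  set b : ℝ → ℝ≥0∞ := fun x => ENNReal.ofReal (√(1 + x ^ 2)) * ‖𝓕 (w : ℝ → ℂ) x‖ₑ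
  have hwc : Continuous (𝓕 (w : ℝ → ℂ)) := continuous_fourier w.integrable
  have hs : ∀ x : ℝ, 0 < √(1 + x ^ 2) := fun x => Real.sqrt_pos.2 (by positivity)
  have hab : ∀ x, ‖𝓕 (w : ℝ → ℂ) x‖ₑ = (a * b) x := by
    intro x
    simp only [a, b, Pi.mul_apply]
    rw [← mul_assoc, ← ENNReal.ofReal_mul (by positivity), inv_mul_cancel₀ (hs x).ne',
      ENNReal.ofReal_one, one_mul]
  have ha : Measurable a := by
    apply ENNReal.measurable_ofReal.comp
    fun_prop
  have hb : Measurable b := by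
    refine (ENNReal.measurable_ofReal.comp ?_).mul hwc.measurable.enorm
    fun_prop
  have hH := ENNReal.lintegral_mul_le_Lp_mul_Lq volume Real.HolderConjugate.two_two
    ha.aemeasurable hb.aemeasurable
  simp only [← hab, ENNReal.rpow_two] at hH
  have h2 : ∀ y : ℝ≥0∞, (y ^ (1 / 2 : ℝ)) ^ 2 = y := fun y => by
    rw [← ENNReal.rpow_natCast, ← ENNReal.rpow_mul]; norm_num
  calc _ ≤ (∫⁻ x, a x ^ 2) * ∫⁻ x, b x ^ 2 := by
        refine (pow_le_pow_left' hH 2).trans (le_of_eq ?_)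
        rw [mul_pow, h2, h2]
    _ ≤ _ := by
        gcongr with x
        · simp only [a]
          rw [← ENNReal.ofReal_pow (by positivity), inv_pow, Real.sq_sqrt (by positivity)]
        · have e : ∀ x, b x ^ 2 ≤ ‖𝓕 (w : ℝ → ℂ) x‖ₑ ^ 2 + ‖𝓕 (deriv (w : ℝ → ℂ)) x‖ₑ ^ 2 := by
            intro x
            simp only [b]
            rw [Real.fourier_deriv w.integrable w.differentiable
              (SchwartzMap.derivCLM ℂ ℂ w).integrable]
            rw [mul_pow, ← ENNReal.ofReal_pow (by positivity), Real.sq_sqrt (by positivity),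
              ENNReal.ofReal_add (by positivity) (by positivity), add_mul, ENNReal.ofReal_one,
              one_mul, enorm_smul, mul_pow]
            gcongr
            rw [← ofReal_norm, ← ENNReal.ofReal_pow (by positivity)]
            refine ENNReal.ofReal_le_ofReal ?_
            have h1 : ‖(2 * Real.pi * Complex.I * x : ℂ)‖ = 2 * Real.pi * |x| := by
              simp [abs_of_pos Real.pi_pos]
            rw [h1, mul_pow, sq_abs]
            have := Real.pi_gt_three
            exact le_mul_of_one_le_left (sq_nonneg x) (by nlinarith)
          refine (lintegral_mono e).trans (le_of_eq ?_)
          have h3 : ∫⁻ x, ‖𝓕 (deriv (w : ℝ → ℂ)) x‖ₑ ^ 2 = ∫⁻ x, ‖deriv w x‖ₑ ^ 2 :=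
            by
              have h4 := lintegral_fourier_sq (SchwartzMap.derivCLM ℂ ℂ w).integrable
                ((SchwartzMap.derivCLM ℂ ℂ w).memLp 2)
              rwa [show ((SchwartzMap.derivCLM ℂ ℂ w : 𝓢(ℝ, ℂ)) : ℝ → ℂ) = deriv w from
                funext fun x => SchwartzMap.derivCLM_apply ℂ w x] at h4
          rw [lintegral_add_left (hwc.measurable.enorm.pow_const 2),
            lintegral_fourier_sq w.integrable (w.memLp 2), h3]

lemma tendsto_lintegral_fourier_schwartz {w : ℕ → 𝓢(ℝ, ℂ)}
    (h0 : Tendsto (fun n => ∫⁻ x, ‖w n x‖ₑ ^ 2) atTop (𝓝 0))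
    (h1 : Tendsto (fun n => ∫⁻ x, ‖deriv (w n) x‖ₑ ^ 2) atTop (𝓝 0)) :
    Tendsto (fun n => ∫⁻ x, ‖𝓕 (w n : ℝ → ℂ) x‖ₑ) atTop (𝓝 0) := by
  have hK : (∫⁻ x : ℝ, ENNReal.ofReal (1 + x ^ 2)⁻¹) ≠ ⊤ :=
    integrable_inv_one_add_sq.lintegral_lt_top.ne
  have h2 := ENNReal.Tendsto.const_mul (h0.add h1) (Or.inr hK)
  rw [add_zero, mul_zero] at h2
  have h3 : Tendsto (fun n => (∫⁻ x, ‖𝓕 (w n : ℝ → ℂ) x‖ₑ) ^ 2) atTop (𝓝 0) :=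
    tendsto_of_tendsto_of_tendsto_of_le_of_le tendsto_const_nhds h2 (fun _ => zero_le)
      fun n => lintegral_fourier_schwartz_sq_le (w n)
  have h4 := h3.ennrpow_const (1 / 2)
  have h5 : ∀ y : ℝ≥0∞, (y ^ 2) ^ (1 / 2 : ℝ) = y := fun y => by
    rw [← ENNReal.rpow_natCast, ← ENNReal.rpow_mul]; norm_num
  simp only [h5] at h4
  rwa [ENNReal.zero_rpow_of_pos (by norm_num)] at h4

lemma tendsto_lintegral_enorm_sq {F : ℕ → ℝ → ℂ} (hF : ∀ n, Continuous (F n)) {b : ℝ → ℝ}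
    (hb : MemLp b 2) (hFb : ∀ n x, ‖F n x‖ ≤ b x)
    (hlim : ∀ᵐ x, ∀ᶠ n in atTop, F n x = 0) :
    Tendsto (fun n => ∫⁻ x, ‖F n x‖ₑ ^ 2) atTop (𝓝 0) := by
  have := tendsto_lintegral_of_dominated_convergence (μ := volume)
    (F := fun n x => ‖F n x‖ₑ ^ 2) (f := fun _ => 0) (fun x => ‖b x‖ₑ ^ 2)
    (fun n => (hF n).measurable.enorm.pow_const 2) (fun n => ae_of_all _ fun x => ?_) ?_ ?_
  · simpa using this
  · simp only
    gcongr
    rw [enorm_le_iff_norm_le]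
    exact (hFb n x).trans (le_abs_self _)
  · have h1 := (hb.ofReal (K := ℂ)).eLpNorm_ne_top
    have h2 := @eLpNorm_two_sq (fun x => (b x : ℂ))
    simp only [enorm_ofReal_eq] at h2
    rw [← h2]
    exact ENNReal.pow_ne_top h1
  · filter_upwards [hlim] with x hx
    refine tendsto_const_nhds.congr' ?_
    filter_upwards [hx] with n hn
    simp [hn]

lemma exists_smooth_cutoff : ∃ κ : ℝ → ℝ, ContDiff ℝ ∞ κ ∧ HasCompactSupport κ ∧
    (∀ t, |t| ≤ 1 → κ t = 1) ∧ (∀ t, 2 ≤ |t| → κ t = 0) ∧ (∀ t, 0 ≤ κ t) ∧ ∀ t, κ t ≤ 1 := by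
  let κ : ContDiffBump (0 : ℝ) := ⟨1, 2, one_pos, one_lt_two⟩
  exact ⟨κ, κ.contDiff, κ.hasCompactSupport,
    fun t ht => κ.one_of_mem_closedBall (by simpa [κ] using ht),
    fun t ht => κ.zero_of_le_dist (by simpa [κ] using ht), κ.nonneg', fun t => κ.le_one⟩

/-- Smooth cutoffs supported away from `0` and `∞`, with scale invariant bounds. -/
lemma exists_annular_cutoffs : ∃ (θ : ℕ → ℝ → ℝ) (K : ℝ), 0 ≤ K ∧
    ∀ n, ContDiff ℝ ∞ (θ n) ∧ HasCompactSupport (θ n) ∧ (θ n =ᶠ[𝓝 0] 0) ∧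
      (∀ ξ, 0 ≤ θ n ξ ∧ θ n ξ ≤ 1) ∧ (∀ ξ, |ξ| * |deriv (θ n) ξ| ≤ K) ∧
      (∀ ξ, ξ ≠ 0 → ∀ᶠ n in atTop, θ n =ᶠ[𝓝 ξ] 1) := by
  obtain ⟨κ, hκ, hκc, hone, hzero, hκ0, hκ1⟩ := exists_smooth_cutoff
  have hκd : Continuous (deriv κ) := hκ.continuous_deriv (by norm_num)
  -- `t κ'(t)` is unchanged by dilation of `κ`, so one bound `K` serves every scale; the two factors
  -- of `θ n` give `K + K`.
  obtain ⟨K, hK⟩ := (hκc.deriv.mul_left (f := fun t : ℝ => t)).exists_bound_of_continuous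
    (continuous_id.mul hκd)
  have hK0 : 0 ≤ K := (norm_nonneg _).trans (hK 0)
  have hN : ∀ n : ℕ, (0 : ℝ) < n + 1 := fun n => by positivity
  refine ⟨fun n ξ => κ (((n : ℝ) + 1)⁻¹ * ξ) * (1 - κ (((n : ℝ) + 1) * ξ)), K + K, by positivity,
    fun n => ⟨?_, ?_, ?_, ?_, ?_, ?_⟩⟩
  · exact (hκ.comp (contDiff_const.mul contDiff_id)).mul
      (contDiff_const.sub (hκ.comp (contDiff_const.mul contDiff_id)))
  · refine HasCompactSupport.mul_right ?_
    exact hκc.comp_homeomorph (Homeomorph.mulLeft₀ _ (inv_ne_zero (hN n).ne'))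
  · have : ∀ᶠ ξ : ℝ in 𝓝 0, |((n : ℝ) + 1) * ξ| < 1 := by
      refine (Continuous.tendsto (by fun_prop) 0).eventually_lt_const ?_
      simp
    filter_upwards [this] with ξ hξ
    simp [hone _ hξ.le]
  · intro ξ
    have a1 := hκ0 (((n : ℝ) + 1)⁻¹ * ξ)
    have a2 := hκ1 (((n : ℝ) + 1)⁻¹ * ξ)
    have a3 := hκ0 (((n : ℝ) + 1) * ξ)
    have a4 := hκ1 (((n : ℝ) + 1) * ξ)
    exact ⟨mul_nonneg a1 (by linarith), mul_le_one₀ a2 (by linarith) (by linarith)⟩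
  · intro ξ
    have d1 : HasDerivAt (fun ξ => κ (((n : ℝ) + 1)⁻¹ * ξ))
        (deriv κ (((n : ℝ) + 1)⁻¹ * ξ) * (((n : ℝ) + 1)⁻¹ * 1)) ξ :=
      HasDerivAt.comp ξ (hκ.differentiable (by norm_num) _).hasDerivAt
        ((hasDerivAt_id ξ).const_mul _)
    have d2 : HasDerivAt (fun ξ => κ (((n : ℝ) + 1) * ξ))
        (deriv κ (((n : ℝ) + 1) * ξ) * (((n : ℝ) + 1) * 1)) ξ :=
      HasDerivAt.comp ξ (hκ.differentiable (by norm_num) _).hasDerivAt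
        ((hasDerivAt_id ξ).const_mul _)
    have d3 := (d1.mul (d2.const_sub 1)).deriv
    change |ξ| * |deriv ((fun ξ => κ (((n : ℝ) + 1)⁻¹ * ξ)) *
      fun x => 1 - κ (((n : ℝ) + 1) * x)) ξ| ≤ K + K
    rw [d3, ← abs_mul]
    have a1 := hκ0 (((n : ℝ) + 1)⁻¹ * ξ)
    have a2 := hκ1 (((n : ℝ) + 1)⁻¹ * ξ)
    have a3 := hκ0 (((n : ℝ) + 1) * ξ)
    have a4 := hκ1 (((n : ℝ) + 1) * ξ)
    have b1 := hK (((n : ℝ) + 1)⁻¹ * ξ)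
    have b2 := hK (((n : ℝ) + 1) * ξ)
    simp only [Real.norm_eq_abs, Pi.mul_apply] at b1 b2
    generalize deriv κ (((n : ℝ) + 1)⁻¹ * ξ) = D1 at *
    generalize deriv κ (((n : ℝ) + 1) * ξ) = D2 at *
    generalize κ (((n : ℝ) + 1)⁻¹ * ξ) = k1 at *
    generalize κ (((n : ℝ) + 1) * ξ) = k2 at *
    have e : ξ * (D1 * (((n : ℝ) + 1)⁻¹ * 1) * (1 - k2) + k1 * -(D2 * (((n : ℝ) + 1) * 1)))
      = (((n : ℝ) + 1)⁻¹ * ξ * D1) * (1 - k2) - (((n : ℝ) + 1) * ξ * D2) * k1 := by ring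
    rw [e]
    refine (abs_sub _ _).trans (add_le_add ?_ ?_)
    · rw [abs_mul, abs_of_nonneg (by linarith : 0 ≤ 1 - k2)]
      exact (mul_le_of_le_one_right (abs_nonneg _) (by linarith)).trans b1
    · rw [abs_mul, abs_of_nonneg a1]
      exact (mul_le_of_le_one_right (abs_nonneg _) a2).trans b2
  · intro ξ hξ
    have hξ' : 0 < |ξ| := abs_pos.2 hξ
    have ht : Tendsto (fun n : ℕ => (n : ℝ) + 1) atTop atTop :=
      tendsto_atTop_add_const_right _ _ tendsto_natCast_atTop_atTop
    filter_upwards [ht.eventually_gt_atTop |ξ|, (ht.atTop_mul_const hξ').eventually_gt_atTop 2]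
      with n h1 h2
    have c1 : ∀ᶠ y : ℝ in 𝓝 ξ, |y| < (n : ℝ) + 1 :=
      (continuous_abs.tendsto ξ).eventually_lt_const h1
    have c2 : ∀ᶠ y : ℝ in 𝓝 ξ, 2 < ((n : ℝ) + 1) * |y| :=
      ((continuous_const.mul continuous_abs).tendsto ξ).eventually_const_lt h2
    filter_upwards [c1, c2] with y h3 h4
    rw [hone _, hzero _]
    · simp
    · rw [abs_mul, abs_of_pos (hN n)]; exact h4.le
    · rw [abs_mul, abs_of_pos (inv_pos.2 (hN n)), inv_mul_le_iff₀ (hN n)]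
      linarith

/-- Multiplication of a Schwartz function by the symbol of a difference operator. -/
noncomputable def diffSymbolMul (h : ℝ) (q : 𝓢(ℝ, ℂ)) : 𝓢(ℝ, ℂ) :=
  𝓕 (SchwartzMap.compSubConstCLM ℂ (-h) (𝓕⁻ q) - 𝓕⁻ q)

lemma diffSymbolMul_apply (h : ℝ) (q : 𝓢(ℝ, ℂ)) (ξ : ℝ) :
    diffSymbolMul h q ξ = diffSymbol h ξ * q ξ := by
  have h1 : ((SchwartzMap.compSubConstCLM ℂ (-h) (𝓕⁻ q) - 𝓕⁻ q : 𝓢(ℝ, ℂ)) : ℝ → ℂ)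
      = fun x => (𝓕⁻ q : 𝓢(ℝ, ℂ)) (x + h) - (𝓕⁻ q : 𝓢(ℝ, ℂ)) x := by
    ext x
    simp
  rw [diffSymbolMul, SchwartzMap.fourier_coe, h1, fourier_comp_add_sub (𝓕⁻ q).integrable,
    ← SchwartzMap.fourier_coe, FourierTransform.fourier_fourierInv_eq]

/-- The product of the bounds `2` and `2π|h||ξ|` has precisely the growth of the squared quarter
symbol. -/
lemma norm_diffSymbol_sq_le (h ξ : ℝ) :
    ‖diffSymbol h ξ‖ ^ 2 ≤ 2 * |h| * quarterSymbol ξ ^ 2 := by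
  rw [quarterSymbol_sq, sq]
  refine (mul_le_mul (norm_diffSymbol_le_two h ξ) (norm_diffSymbol_le h ξ) (norm_nonneg _)
    zero_le_two).trans (le_of_eq ?_)
  ring

lemma norm_diffSymbol_div_le (h ξ : ℝ) :
    ‖diffSymbol h ξ / quarterSymbol ξ‖ ≤ √(2 * |h|) := by
  rcases eq_or_ne ξ 0 with rfl | hξ
  · simp [diffSymbol]
  · have hp := quarterSymbol_pos hξ
    rw [norm_div, Complex.norm_real, Real.norm_of_nonneg hp.le, div_le_iff₀ hp]
    refine abs_le_of_sq_le_sq' ?_ (by positivity) |>.2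
    rw [mul_pow, Real.sq_sqrt (by positivity)]
    exact norm_diffSymbol_sq_le h ξ

lemma contDiff_div_quarterSymbol {θ : ℝ → ℝ} (hθ : ContDiff ℝ ∞ θ) (h0 : θ =ᶠ[𝓝 0] 0) :
    ContDiff ℝ ∞ (fun ξ => θ ξ / quarterSymbol ξ) := by
  rw [contDiff_iff_contDiffAt]
  intro ξ
  rcases eq_or_ne ξ 0 with rfl | hξ
  · refine (contDiffAt_const (c := (0 : ℝ))).congr_of_eventuallyEq ?_
    filter_upwards [h0] with x hx
    simp [hx]
  · refine hθ.contDiffAt.div ?_ (quarterSymbol_pos hξ).ne'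
    refine (contDiffAt_const.mul (contDiffAt_abs hξ)).rpow_const_of_ne ?_
    have := abs_pos.2 hξ
    positivity

lemma measurable_diffSymbol_div (h : ℝ) :
    Measurable (fun ξ => diffSymbol h ξ / quarterSymbol ξ) :=
  (measurable_diffSymbol_right h).div
    (Complex.measurable_ofReal.comp continuous_quarterSymbol.measurable)

/-- Formally `𝓕 G = quarterSymbol · 𝓕 f`, to be multiplied by `diffSymbol / quarterSymbol`. That
quotient times `q` need not be Schwartz, because of the point `0`, so the cutoffs `θ n` are inserted
and then removed in the limit. -/
lemma IsQuarterLaplacian.integral_mul_sub_fourier {f g : ℝ → ℝ} (H : IsQuarterLaplacian f g)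
    {B : ℝ} (hB : ∀ᵐ x, |f x| ≤ B) (G : Lp ℂ 2 (volume : Measure ℝ))
    (hG : G =ᵐ[volume] fun x => (g x : ℂ)) (h : ℝ) (q : 𝓢(ℝ, ℂ)) :
    ∫ x, (f x : ℂ) * (𝓕 (q : ℝ → ℂ) (x - h) - 𝓕 (q : ℝ → ℂ) x) =
      ∫ ξ, (𝓕 G : Lp ℂ 2 (volume : Measure ℝ)) ξ * (diffSymbol h ξ / quarterSymbol ξ) * q ξ := by
  obtain ⟨θ, K, hK0, hθ⟩ := exists_annular_cutoffs
  have hlim : ∀ᵐ ξ : ℝ, ∀ᶠ n in atTop, θ n =ᶠ[𝓝 ξ] 1 := by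
    have : ∀ᵐ ξ : ℝ, ξ ≠ 0 := by simp [ae_iff]
    filter_upwards [this] with ξ hξ using (hθ 0).2.2.2.2.2 ξ hξ
  set A := diffSymbolMul h q
  have hA : ∀ ξ, A ξ = diffSymbol h ξ * q ξ := diffSymbolMul_apply h q
  have hcpt : ∀ n, HasCompactSupport (fun ξ => (θ n ξ : ℂ) * A ξ) := fun n =>
    ((hθ n).2.1.comp_left (g := Complex.ofReal) (by simp)).mul_right
  have hcpt' : ∀ n, HasCompactSupport (fun ξ => ((θ n ξ / quarterSymbol ξ : ℝ) : ℂ) * A ξ) :=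
    fun n => by
      refine HasCompactSupport.mul_right ?_
      refine HasCompactSupport.comp_left (g := Complex.ofReal) ?_ (by simp)
      simp only [div_eq_mul_inv]
      exact (hθ n).2.1.mul_right
  let Aθ : ℕ → 𝓢(ℝ, ℂ) := fun n => (hcpt n).toSchwartzMap
    ((Complex.ofRealCLM.contDiff.comp (hθ n).1).mul (A.smooth ⊤))
  let p : ℕ → 𝓢(ℝ, ℂ) := fun n => (hcpt' n).toSchwartzMap
    ((Complex.ofRealCLM.contDiff.comp (contDiff_div_quarterSymbol (hθ n).1 (hθ n).2.2.1)).mul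
      (A.smooth ⊤))
  have hAθ : ∀ n ξ, Aθ n ξ = (θ n ξ : ℂ) * A ξ := fun n ξ => rfl
  have hp : ∀ n ξ, p n ξ = ((θ n ξ / quarterSymbol ξ : ℝ) : ℂ) * A ξ := fun n ξ => rfl
  have hσp : ∀ n, (fun ξ => (quarterSymbol ξ : ℂ) * p n ξ) = Aθ n := by
    intro n
    ext ξ
    rw [hp, hAθ, ← mul_assoc, ← Complex.ofReal_mul]
    rcases eq_or_ne ξ 0 with rfl | hξ
    · have : θ n 0 = 0 := (hθ n).2.2.1.self_of_nhds
      simp [this]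
    · rw [mul_div_cancel₀ _ (quarterSymbol_pos hξ).ne']
  -- The definition is tested on `ψ = 𝓕 (p n)`, for which `(-Δ)^{1/4} ψ = 𝓕 (Aθ n)`.
  have hid : ∀ n, ∫ x, (f x : ℂ) * 𝓕 (Aθ n : ℝ → ℂ) x
      = ∫ ξ, (𝓕 G : Lp ℂ 2 (volume : Measure ℝ)) ξ * p n ξ := by
    intro n
    have h1 := H.integral_eq (𝓕 (p n))
    rw [quarterLaplacianSchwartz_eq, FourierTransform.fourierInv_fourier_eq, hσp] at h1
    rw [h1, integral_fourier_Lp_mul]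
    refine integral_congr_ae (hG.mono fun x hx => ?_)
    simp only [hx]
    rfl
  have hR : Tendsto (fun n => ∫ ξ, (𝓕 G : Lp ℂ 2 (volume : Measure ℝ)) ξ * p n ξ) atTop
      (𝓝 (∫ ξ, (𝓕 G : Lp ℂ 2 (volume : Measure ℝ)) ξ * (diffSymbol h ξ / quarterSymbol ξ)
        * q ξ)) := by
    refine tendsto_integral_of_dominated_convergence
      (fun ξ => √(2 * |h|) * ‖(𝓕 G : Lp ℂ 2 (volume : Measure ℝ)) ξ * q ξ‖) (fun n => ?_) ?_
      (fun n => ae_of_all _ fun ξ => ?_) ?_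
    · exact (Lp.aestronglyMeasurable _).mul (p n).continuous.aestronglyMeasurable
    · exact (((Lp.memLp (𝓕 G)).integrable_mul (q.memLp 2)).norm).const_mul _
    · have h1 : p n ξ = (θ n ξ : ℂ) * (diffSymbol h ξ / quarterSymbol ξ) * q ξ := by
        rw [hp, hA]; push_cast; ring
      rw [h1, norm_mul, norm_mul, norm_mul, norm_mul, Complex.norm_real,
        Real.norm_of_nonneg ((hθ n).2.2.2.1 ξ).1]
      have h2 := mul_le_mul ((hθ n).2.2.2.1 ξ).2 (norm_diffSymbol_div_le h ξ) (norm_nonneg _)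
        zero_le_one
      rw [one_mul] at h2
      calc _ = (θ n ξ * ‖diffSymbol h ξ / quarterSymbol ξ‖) *
            (‖(𝓕 G : Lp ℂ 2 (volume : Measure ℝ)) ξ‖ * ‖q ξ‖) := by ring
        _ ≤ _ := mul_le_mul_of_nonneg_right h2 (by positivity)
    · filter_upwards [hlim] with ξ hξ
      refine tendsto_const_nhds.congr' ?_
      filter_upwards [hξ] with n hn
      have : θ n ξ = 1 := hn.self_of_nhds
      rw [hp, hA, this]
      push_cast
      ring
  have hL1 : Tendsto (fun n => ∫⁻ x, ‖𝓕 ((A - Aθ n : 𝓢(ℝ, ℂ)) : ℝ → ℂ) x‖ₑ) atTop (𝓝 0) := by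
    refine tendsto_lintegral_fourier_schwartz ?_ ?_
    · refine tendsto_lintegral_enorm_sq (fun n => (A - Aθ n).continuous) (A.memLp 2).norm
        (fun n x => ?_) ?_
      · have : (A - Aθ n) x = ((1 - θ n x : ℝ) : ℂ) * A x := by
          rw [sub_apply, hAθ]; push_cast; ring
        rw [this, norm_mul, Complex.norm_real]
        refine mul_le_of_le_one_left (norm_nonneg _) ?_
        have := (hθ n).2.2.2.1 x
        rw [Real.norm_eq_abs, abs_le]; constructor <;> linarith
      · filter_upwards [hlim] with ξ hξ
        filter_upwards [hξ] with n hn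
        have : θ n ξ = 1 := hn.self_of_nhds
        rw [sub_apply, hAθ, this]; simp
    -- The derivative of `θ n` blows up near `0`, but `A` vanishes there like `|ξ|`, so the bound on
    -- `|ξ| |θ n'|` gives an `L²` majorant.
    · have hder : ∀ n x, deriv (A - Aθ n : 𝓢(ℝ, ℂ)) x
          = ((1 - θ n x : ℝ) : ℂ) * deriv A x - ((deriv (θ n) x : ℝ) : ℂ) * A x := by
        intro n x
        have d1 : HasDerivAt (θ n) (deriv (θ n) x) x :=
          ((hθ n).1.differentiable (by norm_num) x).hasDerivAt
        have d2 := (A.hasDerivAt x).sub (d1.ofReal_comp.mul (A.hasDerivAt x))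
        have e : ((A - Aθ n : 𝓢(ℝ, ℂ)) : ℝ → ℂ) = ⇑A - (fun y => (θ n y : ℂ)) * ⇑A := by
          ext y; simp [hAθ]
        rw [e, d2.deriv]
        push_cast
        ring
      have hA' : MemLp (fun x => ‖deriv A x‖) 2 := by
        have := ((SchwartzMap.derivCLM ℂ ℂ A).memLp 2).norm
        simpa only [SchwartzMap.derivCLM_apply] using this
      refine tendsto_lintegral_enorm_sq (fun n => ?_)
        (hA'.add ((q.memLp 2).norm.const_mul (2 * Real.pi * |h| * K))) (fun n x => ?_) ?_
      · exact ((A - Aθ n).smooth ⊤).continuous_deriv (by norm_num)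
      · rw [hder]
        refine (norm_sub_le _ _).trans (add_le_add ?_ ?_)
        · rw [norm_mul, Complex.norm_real]
          refine mul_le_of_le_one_left (norm_nonneg _) ?_
          have := (hθ n).2.2.2.1 x
          rw [Real.norm_eq_abs, abs_le]; constructor <;> linarith
        · rw [norm_mul, Complex.norm_real, hA, norm_mul, Real.norm_eq_abs]
          have h1 := (hθ n).2.2.2.2.1 x
          have h2 := norm_diffSymbol_le h x
          calc _ ≤ |deriv (θ n) x| * (2 * Real.pi * (|h| * |x|) * ‖q x‖) := by gcongr
            _ = 2 * Real.pi * |h| * (|x| * |deriv (θ n) x|) * ‖q x‖ := by ring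
            _ ≤ 2 * Real.pi * |h| * K * ‖q x‖ := by
              have := Real.pi_pos
              gcongr
            _ = _ := rfl
      · filter_upwards [hlim] with ξ hξ
        filter_upwards [hξ] with n hn
        have h1 : θ n ξ = 1 := hn.self_of_nhds
        have h2 : deriv (θ n) ξ = 0 := by rw [hn.deriv_eq]; simp
        rw [hder, h1, h2]; simp
  have hfm : AEStronglyMeasurable (fun x => (f x : ℂ)) volume :=
    Complex.continuous_ofReal.comp_aestronglyMeasurable H.locallyIntegrable.aestronglyMeasurable
  have hBc : ∀ᵐ x, ‖(f x : ℂ)‖ ≤ B := by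
    filter_upwards [hB] with x hx
    rwa [Complex.norm_real]
  have hfi : ∀ w : 𝓢(ℝ, ℂ), Integrable (fun x => (f x : ℂ) * 𝓕 (w : ℝ → ℂ) x) := fun w =>
    (𝓕 w).integrable.bdd_mul hfm hBc
  have hL : Tendsto (fun n => ∫ x, (f x : ℂ) * 𝓕 (Aθ n : ℝ → ℂ) x) atTop
      (𝓝 (∫ x, (f x : ℂ) * 𝓕 (A : ℝ → ℂ) x)) := by
    rw [tendsto_iff_norm_sub_tendsto_zero]
    have h1 : Tendsto (fun n => (ENNReal.ofReal B *
        ∫⁻ x, ‖𝓕 ((A - Aθ n : 𝓢(ℝ, ℂ)) : ℝ → ℂ) x‖ₑ).toReal) atTop (𝓝 0) := by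
      have := ENNReal.Tendsto.const_mul (a := ENNReal.ofReal B) hL1 (Or.inr ENNReal.ofReal_ne_top)
      rw [mul_zero] at this
      exact (ENNReal.tendsto_toReal ENNReal.zero_ne_top).comp this
    refine squeeze_zero (fun _ => norm_nonneg _) (fun n => ?_) h1
    rw [← integral_sub (hfi _) (hfi _), ← lintegral_const_mul' _ _ ENNReal.ofReal_ne_top]
    refine (norm_integral_le_lintegral_norm _).trans (ENNReal.toReal_mono ?_ (lintegral_mono_ae ?_))
    · rw [lintegral_const_mul' _ _ ENNReal.ofReal_ne_top]
      exact ENNReal.mul_ne_top ENNReal.ofReal_ne_top (𝓕 (A - Aθ n)).integrable.2.ne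
    · filter_upwards [hBc] with x hx
      have e : 𝓕 ((A - Aθ n : 𝓢(ℝ, ℂ)) : ℝ → ℂ) x = 𝓕 (A : ℝ → ℂ) x - 𝓕 (Aθ n : ℝ → ℂ) x := by
        have : 𝓕 (A - Aθ n) = 𝓕 A - 𝓕 (Aθ n) := map_sub (FourierTransform.fourierCLM ℂ 𝓢(ℝ, ℂ)) _ _
        exact congrArg (fun w : 𝓢(ℝ, ℂ) => w x) this
      rw [← mul_sub, ← norm_neg, ← mul_neg, neg_sub, ← e, norm_mul,
        ENNReal.ofReal_mul (norm_nonneg _), ofReal_norm (𝓕 ((A - Aθ n : 𝓢(ℝ, ℂ)) : ℝ → ℂ) x)]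
      gcongr
  have hfin := tendsto_nhds_unique (hL.congr hid) hR
  rw [← hfin]
  congr 1 with x
  rw [show (A : ℝ → ℂ) = fun ξ => diffSymbol h ξ * q ξ from funext hA,
    fourier_diffSymbol_mul q.integrable]

/-- Each difference lies in `L²` with transform `Γ · diffSymbol / quarterSymbol`. Integrating its
squared norm against `dh / h²` produces a factor `|ξ|`, cancelled by the squared quarter symbol,
which leaves a multiple of `‖g‖²`. -/
lemma IsQuarterLaplacian.gagliardo_ne_top {f g : ℝ → ℝ} (H : IsQuarterLaplacian f g)
    {B : ℝ} (hB : ∀ᵐ x, |f x| ≤ B) : gagliardo f ≠ ⊤ := by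
  have hg : MemLp (fun x => (g x : ℂ)) 2 := H.memLp.ofReal
  set G : Lp ℂ 2 (volume : Measure ℝ) := hg.toLp _
  have hG : G =ᵐ[volume] fun x => (g x : ℂ) := hg.coeFn_toLp
  set Γ : Lp ℂ 2 (volume : Measure ℝ) := 𝓕 G
  have hfm : AEStronglyMeasurable f volume := H.locallyIntegrable.aestronglyMeasurable
  have hfc : AEStronglyMeasurable (fun x => (f x : ℂ)) volume :=
    Complex.continuous_ofReal.comp_aestronglyMeasurable hfm
  have hBc : ∀ᵐ x, ‖(f x : ℂ)‖ ≤ B := by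
    filter_upwards [hB] with x hx
    rwa [Complex.norm_real]
  have hshift : ∀ h : ℝ, ∫⁻ x, ‖f (x + h) - f x‖ₑ ^ 2
      = ∫⁻ ξ, ‖diffSymbol h ξ‖ₑ ^ 2 * (‖Γ ξ‖ₑ ^ 2 / ‖quarterSymbol ξ‖ₑ ^ 2) := by
    intro h
    have hN : MemLp (fun ξ => Γ ξ * (diffSymbol h ξ / quarterSymbol ξ)) 2 :=
      MemLp.of_le_mul (c := √(2 * |h|)) (Lp.memLp Γ)
        ((Lp.aestronglyMeasurable Γ).mul (measurable_diffSymbol_div h).aestronglyMeasurable)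
        (ae_of_all _ fun ξ => by
          rw [norm_mul, mul_comm]
          exact mul_le_mul_of_nonneg_right (norm_diffSymbol_div_le h ξ) (norm_nonneg _))
    set Φ : Lp ℂ 2 (volume : Measure ℝ) := 𝓕⁻ (hN.toLp _) with hΦ
    have hFΦ : 𝓕 Φ = hN.toLp _ := by rw [hΦ, FourierTransform.fourier_fourierInv_eq]
    have hfh : AEStronglyMeasurable (fun x => (f (x + h) : ℂ)) volume :=
      hfc.comp_measurePreserving (measurePreserving_add_right volume h)
    have hBh : ∀ᵐ x, ‖(f (x + h) : ℂ)‖ ≤ B :=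
      (measurePreserving_add_right volume h).quasiMeasurePreserving.ae hBc
    have hD : (fun x => ((f (x + h) - f x : ℝ) : ℂ)) =ᵐ[volume] Φ := by
      refine ae_eq_of_integral_mul_schwartz ?_ ((Lp.memLp Φ).locallyIntegrable (by norm_num))
        fun ψ => ?_
      · have h1 : MemLp (fun x => ((f (x + h) - f x : ℝ) : ℂ)) ⊤ := by
          refine memLp_top_of_bound (C := B + B) ?_ ?_
          · push_cast
            exact hfh.sub hfc
          · filter_upwards [hBc, hBh] with x h1 h2
            push_cast
            exact (norm_sub_le _ _).trans (add_le_add h2 h1)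
        exact h1.locallyIntegrable le_top
      · have hq : 𝓕 ((𝓕⁻ ψ : 𝓢(ℝ, ℂ)) : ℝ → ℂ) = ψ := by
          rw [← SchwartzMap.fourier_coe, FourierTransform.fourier_fourierInv_eq]
        have h1 := H.integral_mul_sub_fourier hB G hG h (𝓕⁻ ψ)
        have h2 := integral_fourier_Lp_mul Φ (𝓕⁻ ψ)
        rw [hq, hFΦ] at h2
        rw [hq] at h1
        rw [← h2]
        have h3 : ∫ x, (hN.toLp _ : Lp ℂ 2 (volume : Measure ℝ)) x * (𝓕⁻ ψ : 𝓢(ℝ, ℂ)) x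
            = ∫ ξ, Γ ξ * (diffSymbol h ξ / quarterSymbol ξ) * (𝓕⁻ ψ : 𝓢(ℝ, ℂ)) ξ :=
          integral_congr_ae (hN.coeFn_toLp.mono fun x hx => by simp only [hx])
        rw [h3, ← h1]
        have i1 : Integrable fun x => (f (x + h) : ℂ) * ψ x := ψ.integrable.bdd_mul hfh hBh
        have i2 : Integrable fun x => (f x : ℂ) * ψ x := ψ.integrable.bdd_mul hfc hBc
        have i3 : Integrable fun x => (f x : ℂ) * ψ (x - h) :=
          (ψ.integrable.comp_sub_right h).bdd_mul hfc hBc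
        simp only [Complex.ofReal_sub, sub_mul, mul_sub]
        rw [integral_sub i1 i2, integral_sub i3 i2]
        congr 1
        rw [← integral_add_right_eq_self (fun x => (f x : ℂ) * ψ (x - h)) h]
        simp
    have h1 : ‖Φ‖ₑ = ‖hN.toLp _‖ₑ := by
      rw [← ofReal_norm, ← ofReal_norm, ← hFΦ, Lp.norm_fourier_eq]
    have h2 := congrArg (· ^ 2) h1
    simp only [enorm_Lp_sq] at h2
    have h3 := lintegral_congr_ae (hD.fun_comp fun z => ‖z‖ₑ ^ 2)
    have h4 := lintegral_congr_ae (hN.coeFn_toLp.fun_comp fun z => ‖z‖ₑ ^ 2)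
    simp only [Function.comp_def, enorm_ofReal_eq] at h3 h4
    rw [h3, h2, h4]
    have h0 : ∀ᵐ ξ : ℝ, ξ ≠ 0 := by simp [ae_iff]
    refine lintegral_congr_ae (h0.mono fun ξ hξ => ?_)
    have hσ : (quarterSymbol ξ : ℂ) ≠ 0 := by
      exact_mod_cast (quarterSymbol_pos hξ).ne'
    have e : ‖diffSymbol h ξ / quarterSymbol ξ‖ₑ = ‖diffSymbol h ξ‖ₑ / ‖quarterSymbol ξ‖ₑ := by
      rw [div_eq_mul_inv, enorm_mul, enorm_inv hσ, enorm_ofReal_eq, div_eq_mul_inv]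
    simp only
    rw [enorm_mul, mul_pow, e, div_eq_mul_inv, mul_pow, div_eq_mul_inv, ENNReal.inv_pow]
    ring
  have hFm : AEMeasurable (fun ξ => ‖Γ ξ‖ₑ ^ 2 / ‖quarterSymbol ξ‖ₑ ^ 2) :=
    ((Lp.aestronglyMeasurable Γ).enorm.pow_const 2).div
      (continuous_quarterSymbol.measurable.enorm.pow_const 2).aemeasurable
  rw [gagliardo]
  simp only [hshift]
  rw [lintegral_lintegral_diffSymbol hFm]
  refine ENNReal.mul_ne_top kernelConst_ne_top ?_
  have hΓ : ∫⁻ ξ, ‖Γ ξ‖ₑ ^ 2 ≠ ⊤ := by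
    rw [← enorm_Lp_sq]; finiteness
  have h2π : ENNReal.ofReal (2 * Real.pi) ≠ 0 := by
    simpa using Real.pi_pos
  refine ne_top_of_le_ne_top (ENNReal.mul_ne_top (ENNReal.inv_ne_top.2 h2π) hΓ) ?_
  rw [← lintegral_const_mul' _ _ (ENNReal.inv_ne_top.2 h2π)]
  refine lintegral_mono fun ξ => ?_
  -- At `ξ = 0` the quotient may be `⊤`, but it is multiplied by `0`.
  rcases eq_or_ne ξ 0 with rfl | hξ
  · simp
  have hξ0 : ‖ξ‖ₑ ≠ 0 := by simpa using hξ
  rw [enorm_quarterSymbol_sq, div_eq_mul_inv, ENNReal.mul_inv (Or.inl h2π) (Or.inr hξ0)]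
  refine le_of_eq ?_
  calc _ = (‖ξ‖ₑ * ‖ξ‖ₑ⁻¹) * ((ENNReal.ofReal (2 * Real.pi))⁻¹ * ‖Γ ξ‖ₑ ^ 2) := by ring
    _ = _ := by rw [ENNReal.mul_inv_cancel hξ0 (by finiteness), one_mul]

/-! ### Products, dilations and test functions in the Gagliardo seminorm -/

lemma enorm_sq_eq_ofReal (r : ℝ) : ‖r‖ₑ ^ 2 = ENNReal.ofReal (r ^ 2) := by
  rw [← enorm_pow, Real.enorm_of_nonneg (sq_nonneg r)]

/-- The difference of `f η` splits as `η (x + h) (f (x + h) - f x) + f x (η (x + h) - η x)`; then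
`(a + b)² ≤ 2a² + 2b²`. -/
lemma gagliardo_mul_le {f η : ℝ → ℝ} {B M : ℝ} (hB : ∀ᵐ x, |f x| ≤ B) (hη : Continuous η)
    (hM : ∀ x, |η x| ≤ M) :
    gagliardo (fun x => f x * η x) ≤
      ENNReal.ofReal (2 * M ^ 2) * gagliardo f + ENNReal.ofReal (2 * B ^ 2) * gagliardo η := by
  have hm2 : Measurable (fun p : ℝ × ℝ => ‖η (p.2 + p.1) - η p.2‖ₑ ^ 2) :=
    Continuous.measurable (by fun_prop)
  have hm : Measurable (fun h : ℝ => ∫⁻ x, ‖η (x + h) - η x‖ₑ ^ 2) := hm2.lintegral_prod_right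
  have key : ∀ h : ℝ, (∫⁻ x, ‖f (x + h) * η (x + h) - f x * η x‖ₑ ^ 2) / ‖h‖ₑ ^ 2 ≤
      ENNReal.ofReal (2 * M ^ 2) * ((∫⁻ x, ‖f (x + h) - f x‖ₑ ^ 2) / ‖h‖ₑ ^ 2) +
      ENNReal.ofReal (2 * B ^ 2) * ((∫⁻ x, ‖η (x + h) - η x‖ₑ ^ 2) / ‖h‖ₑ ^ 2) := by
    intro h
    rw [← mul_div_assoc, ← mul_div_assoc, ENNReal.div_add_div_same,
      ← lintegral_const_mul' _ _ ENNReal.ofReal_ne_top,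
      ← lintegral_const_mul' _ _ ENNReal.ofReal_ne_top, ← lintegral_add_right]
    · refine ENNReal.div_le_div_right (lintegral_mono_ae ?_) _
      filter_upwards [hB] with x hx
      simp only [enorm_sq_eq_ofReal]
      rw [← ENNReal.ofReal_mul (by positivity), ← ENNReal.ofReal_mul (by positivity),
        ← ENNReal.ofReal_add (by positivity) (by positivity)]
      refine ENNReal.ofReal_le_ofReal ?_
      have h1 : η (x + h) ^ 2 ≤ M ^ 2 := by
        rw [← sq_abs]; have := hM (x + h); gcongr
      have h2 : f x ^ 2 ≤ B ^ 2 := by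
        rw [← sq_abs]; gcongr
      have h3 := mul_le_mul_of_nonneg_right h1 (sq_nonneg (f (x + h) - f x))
      have h4 := mul_le_mul_of_nonneg_right h2 (sq_nonneg (η (x + h) - η x))
      have h5 := sq_nonneg (η (x + h) * (f (x + h) - f x) - f x * (η (x + h) - η x))
      nlinarith
    · have : Continuous fun x => ‖η (x + h) - η x‖ₑ ^ 2 := by fun_prop
      exact this.measurable.const_mul _
  refine (lintegral_mono key).trans (le_of_eq ?_)
  rw [lintegral_add_right, lintegral_const_mul' _ _ ENNReal.ofReal_ne_top,
    lintegral_const_mul' _ _ ENNReal.ofReal_ne_top]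
  · rfl
  · exact (hm.div (measurable_enorm.pow_const 2)).const_mul _

/-- Under dilation the Jacobians of `dx` and `dh` exactly balance `1 / h²`. This invariance keeps
the shrinking cutoffs at bounded energy. -/
lemma gagliardo_comp_mul_sub (ρ : ℝ → ℝ) {c : ℝ} (hc : c ≠ 0) (a : ℝ) :
    gagliardo (fun x => ρ (c * (x - a))) = gagliardo ρ := by
  have hc0 : ‖c‖ₑ ≠ 0 := by simpa using hc
  have hct : ‖c‖ₑ ≠ ⊤ := by finiteness
  have h1 : ∀ h : ℝ, ∫⁻ x, ‖ρ (c * (x + h - a)) - ρ (c * (x - a))‖ₑ ^ 2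
      = ∫⁻ x, ‖ρ (c * x + c * h) - ρ (c * x)‖ₑ ^ 2 := by
    intro h
    rw [← lintegral_sub_right_eq_self (fun x => ‖ρ (c * x + c * h) - ρ (c * x)‖ₑ ^ 2) a]
    refine lintegral_congr fun x => ?_
    rw [← mul_add, sub_add_eq_add_sub]
  have h2 : ∀ t : ℝ, ∫⁻ y, ‖ρ (y + t) - ρ y‖ₑ ^ 2
      = ‖c‖ₑ * ∫⁻ x, ‖ρ (c * x + t) - ρ (c * x)‖ₑ ^ 2 := fun t =>
    lintegral_eq_mul_lintegral_comp_mul_left (fun y => ‖ρ (y + t) - ρ y‖ₑ ^ 2) hc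
  simp only [gagliardo, h1, h2]
  rw [lintegral_eq_mul_lintegral_comp_mul_left
    (fun h => ‖c‖ₑ * (∫⁻ x, ‖ρ (c * x + h) - ρ (c * x)‖ₑ ^ 2) / ‖h‖ₑ ^ 2) hc,
    ← lintegral_const_mul' _ _ hct]
  refine lintegral_congr fun h => ?_
  rw [enorm_mul, mul_pow, ← mul_div_assoc, ← mul_assoc, ← sq,
    ENNReal.mul_div_mul_left _ _ (by simpa using hc) (by finiteness)]

lemma gagliardo_one_sub (κ : ℝ → ℝ) : gagliardo (fun x => 1 - κ x) = gagliardo κ := by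
  have : ∀ x y : ℝ, ‖1 - κ x - (1 - κ y)‖ₑ = ‖κ x - κ y‖ₑ := fun x y => by
    rw [sub_sub_sub_cancel_left, ← enorm_neg, neg_sub]
  simp only [gagliardo, this]

lemma gagliardo_ne_top_of_contDiff {φ : ℝ → ℝ} (hφ : ContDiff ℝ ∞ φ) (hc : HasCompactSupport φ) :
    gagliardo φ ≠ ⊤ := by
  rw [gagliardo_eq_fourier (hφ.continuous.integrable_of_hasCompactSupport hc)
    (hφ.continuous.memLp_of_hasCompactSupport hc)]
  refine ENNReal.mul_ne_top kernelConst_ne_top ?_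
  have hc' : HasCompactSupport (fun x => (φ x : ℂ)) := hc.comp_left (g := Complex.ofReal) (by simp)
  set S : 𝓢(ℝ, ℂ) := 𝓕 (hc'.toSchwartzMap (Complex.ofRealCLM.contDiff.comp hφ)) with hS
  have hS' : 𝓕 (fun x => (φ x : ℂ)) = S := rfl
  obtain ⟨C, -, hC⟩ := S.decay 0 0
  have h1 : Integrable (fun ξ => (‖ξ‖ ^ 1 * ‖S ξ‖) * ‖S ξ‖) :=
    (S.integrable_pow_mul volume 1).mul_bdd (c := C) S.continuous.norm.aestronglyMeasurable
      (ae_of_all _ fun ξ => by simpa using hC ξ)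
  rw [hS']
  convert! h1.2.ne using 2
  ext ξ
  rw [enorm_mul, enorm_mul, pow_one, enorm_norm, enorm_norm, sq, mul_assoc]

/-! ### Uniqueness and weak convergence of quarter Laplacians -/

/-- Lets bounds proved for a constructed `g` pass to the chosen representative `quarterLaplacian f`.
-/
lemma IsQuarterLaplacian.ae_eq {f g g' : ℝ → ℝ} (h : IsQuarterLaplacian f g)
    (h' : IsQuarterLaplacian f g') : g =ᵐ[volume] g' := by
  have := ae_eq_of_integral_mul_schwartz
    (h.memLp.ofReal (K := ℂ) |>.locallyIntegrable (by norm_num))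
    (h'.memLp.ofReal (K := ℂ) |>.locallyIntegrable (by norm_num))
    fun q => (h.integral_eq q).symm.trans (h'.integral_eq q)
  filter_upwards [this] with x hx
  exact_mod_cast hx

lemma MemHomHalf.isQuarterLaplacian {f : ℝ → ℝ} (h : MemHomHalf f) :
    IsQuarterLaplacian f (quarterLaplacian f) := by
  rw [quarterLaplacian, dif_pos h]
  exact h.choose_spec

/-- Boundedness in `L²` and convergence on the dense Schwartz functions give weak convergence. -/
lemma tendsto_integral_mul_of_tendsto_schwartz {g : ℕ → ℝ → ℝ} {g₀ G : ℝ → ℝ}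
    (hg : ∀ n, MemLp (g n) 2) (hg₀ : MemLp g₀ 2) (hG : MemLp G 2) {C : ℝ≥0∞} (hC : C ≠ ⊤)
    (hgC : ∀ n, ∫⁻ x, ‖g n x‖ₑ ^ 2 ≤ C)
    (hlim : ∀ ψ : 𝓢(ℝ, ℂ), Tendsto (fun n => ∫ x, (g n x : ℂ) * ψ x) atTop
      (𝓝 (∫ x, (g₀ x : ℂ) * ψ x))) :
    Tendsto (fun n => ∫ x, G x * g n x) atTop (𝓝 (∫ x, G x * g₀ x)) := by
  let γ : ℕ → Lp ℂ 2 (volume : Measure ℝ) := fun n => ((hg n).ofReal (K := ℂ)).toLp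
  let γ₀ : Lp ℂ 2 (volume : Measure ℝ) := (hg₀.ofReal (K := ℂ)).toLp
  let Γ : Lp ℂ 2 (volume : Measure ℝ) := (hG.ofReal (K := ℂ)).toLp
  have hinner : ∀ {a : ℝ → ℝ} {b : ℝ → ℂ} (ha : MemLp (fun x => (a x : ℂ)) 2 volume)
      (hb : MemLp b 2 volume), inner ℂ (ha.toLp) (hb.toLp) = ∫ x, (a x : ℂ) * b x := by
    intro a b ha hb
    rw [L2.inner_def]
    refine integral_congr_ae ?_
    filter_upwards [ha.coeFn_toLp, hb.coeFn_toLp] with x h1 h2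
    rw [h1, h2, RCLike.inner_apply, Complex.conj_ofReal, mul_comm]
  have hbound : ∃ R, 0 < R ∧ ∀ n, ‖γ n - γ₀‖ ≤ R := by
    refine ⟨C.toReal + 1 + ‖γ₀‖, by positivity, fun n => (norm_sub_le _ _).trans ?_⟩
    gcongr
    have h1 : ‖γ n‖ₑ ^ 2 ≤ C := by
      rw [enorm_Lp_sq]
      refine (le_of_eq (lintegral_congr_ae
        (((hg n).ofReal (K := ℂ)).coeFn_toLp.fun_comp fun z => ‖z‖ₑ ^ 2))).trans ?_
      simpa only [Function.comp_def, RCLike.ofReal_eq_complex_ofReal, enorm_ofReal_eq] using hgC n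
    have h2 := ENNReal.toReal_mono hC h1
    rw [ENNReal.toReal_pow, toReal_enorm] at h2
    nlinarith [sq_nonneg (‖γ n‖ - 1), norm_nonneg (γ n)]
  obtain ⟨R, hR, hγ⟩ := hbound
  have hdense : Tendsto (fun n => (inner ℂ (γ n) Γ : ℂ)) atTop (𝓝 (inner ℂ γ₀ Γ)) := by
    rw [Metric.tendsto_atTop]
    intro ε hε
    obtain ⟨ψ, hψ⟩ := (SchwartzMap.denseRange_toLpCLM (F := ℂ) (p := 2) (μ := (volume : Measure ℝ))
      ENNReal.ofNat_ne_top).exists_dist_lt Γ (show 0 < ε / (2 * R) by positivity)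
    have h1 : Tendsto (fun n => (inner ℂ (γ n) (ψ.toLp 2) : ℂ)) atTop
        (𝓝 (inner ℂ γ₀ (ψ.toLp 2))) := by
      have e1 : ∀ n, (inner ℂ (γ n) (ψ.toLp 2) : ℂ) = ∫ x, (g n x : ℂ) * ψ x := fun n =>
        hinner _ (ψ.memLp 2)
      have e2 : (inner ℂ γ₀ (ψ.toLp 2) : ℂ) = ∫ x, (g₀ x : ℂ) * ψ x := hinner _ (ψ.memLp 2)
      rw [e2]
      simpa only [e1] using hlim ψ
    obtain ⟨N, hN⟩ := Metric.tendsto_atTop.1 h1 (ε / 2) (by positivity)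
    refine ⟨N, fun n hn => ?_⟩
    have h2 := hN n hn
    rw [dist_eq_norm, ← inner_sub_left] at h2 ⊢
    rw [SchwartzMap.toLpCLM_apply, dist_eq_norm] at hψ
    have h3 : (inner ℂ (γ n - γ₀) Γ : ℂ)
        = inner ℂ (γ n - γ₀) (Γ - ψ.toLp 2 volume) + inner ℂ (γ n - γ₀) (ψ.toLp 2 volume) := by
      rw [← inner_add_right, sub_add_cancel]
    have h4 : ‖(inner ℂ (γ n - γ₀) (Γ - ψ.toLp 2 volume) : ℂ)‖ ≤ ε / 2 :=
      calc _ ≤ ‖γ n - γ₀‖ * ‖Γ - ψ.toLp 2 volume‖ := norm_inner_le_norm _ _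
        _ ≤ R * (ε / (2 * R)) := by gcongr; exact hγ n
        _ = ε / 2 := by field_simp
    rw [h3]
    refine (norm_add_le _ _).trans_lt ?_
    linarith
  have e : ∀ {a : ℝ → ℝ} (ha : MemLp (fun x => (a x : ℂ)) 2 volume),
      (inner ℂ ha.toLp Γ : ℂ).re = ∫ x, G x * a x := by
    intro a ha
    rw [hinner ha (hG.ofReal (K := ℂ))]
    simp only [RCLike.ofReal_eq_complex_ofReal, ← Complex.ofReal_mul]
    rw [integral_complex_ofReal, Complex.ofReal_re]
    simp only [mul_comm]
  have h5 := (Complex.continuous_re.tendsto _).comp hdense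
  have e1 : ∀ n, (inner ℂ (γ n) Γ : ℂ).re = ∫ x, G x * g n x := fun n => e _
  have e2 : (inner ℂ γ₀ Γ : ℂ).re = ∫ x, G x * g₀ x := e _
  simpa only [Function.comp_def, e1, e2] using h5

section Product

variable {f φ : ℝ → ℝ} {B : ℝ}

lemma memLp_mul_of_bounded (hf : AEStronglyMeasurable f volume) (hB : ∀ᵐ x, |f x| ≤ B)
    (hφ : ContDiff ℝ ∞ φ) (hc : HasCompactSupport φ) (p : ℝ≥0∞) :
    MemLp (fun x => f x * φ x) p := by
  refine (hφ.continuous.memLp_of_hasCompactSupport (p := p) (μ := volume) hc).of_le_mul (c := B)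
    (hf.mul hφ.continuous.aestronglyMeasurable) ?_
  filter_upwards [hB] with x hx
  rw [norm_mul]
  exact mul_le_mul_of_nonneg_right hx (norm_nonneg _)

lemma memHomHalf_mul (hf : AEStronglyMeasurable f volume) (hB : ∀ᵐ x, |f x| ≤ B)
    (hfin : gagliardo f ≠ ⊤) (hφ : ContDiff ℝ ∞ φ) (hc : HasCompactSupport φ) :
    MemHomHalf (fun x => f x * φ x) ∧
      kernelConst * ∫⁻ x, ‖quarterLaplacian (fun x => f x * φ x) x‖ₑ ^ 2 ≤
        ENNReal.ofReal (2 * Real.pi) * gagliardo (fun x => f x * φ x) := by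
  obtain ⟨M, hM⟩ := hc.exists_bound_of_continuous hφ.continuous
  have hfin' : gagliardo (fun x => f x * φ x) ≠ ⊤ := by
    have := gagliardo_ne_top_of_contDiff hφ hc
    refine ne_top_of_le_ne_top ?_ (gagliardo_mul_le hB hφ.continuous hM)
    finiteness
  obtain ⟨g, hg, hgb⟩ := exists_isQuarterLaplacian
    (memLp_one_iff_integrable.1 (memLp_mul_of_bounded hf hB hφ hc 1))
    (memLp_mul_of_bounded hf hB hφ hc 2) hfin'
  have hm : MemHomHalf (fun x => f x * φ x) := ⟨g, hg⟩
  refine ⟨hm, ?_⟩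
  have h1 := hm.isQuarterLaplacian.ae_eq hg
  have h2 := lintegral_congr_ae (h1.fun_comp fun z => ‖z‖ₑ ^ 2)
  simp only [Function.comp_def] at h2
  rwa [h2]

end Product

/-! ### Cutting out the points -/

/-- By the product rule, each further point doubles the bound and adds a multiple of `gagliardo κ`,
which by dilation invariance does not depend on `n`. -/
lemma exists_gagliardo_prod_bound {φ κ : ℝ → ℝ} (hφ : ContDiff ℝ ∞ φ) (hc : HasCompactSupport φ)
    (hκ : ContDiff ℝ ∞ κ) (hκc : HasCompactSupport κ) (hκ0 : ∀ t, 0 ≤ κ t) (hκ1 : ∀ t, κ t ≤ 1)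
    (A : Finset ℝ) :
    ∃ C : ℝ≥0∞, C ≠ ⊤ ∧ ∀ n : ℕ,
      gagliardo (fun x => φ x * ∏ a ∈ A, (1 - κ (((n : ℝ) + 1) * (x - a)))) ≤ C := by
  obtain ⟨M, hM⟩ := hc.exists_bound_of_continuous hφ.continuous
  have hρ : ∀ t, |1 - κ t| ≤ 1 := fun t => by
    rw [abs_le]; constructor <;> linarith [hκ0 t, hκ1 t]
  induction A using Finset.induction_on with
  | empty => exact ⟨gagliardo φ, gagliardo_ne_top_of_contDiff hφ hc, fun n => by simp⟩
  | insert a s ha ih =>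
    obtain ⟨C, hC, hCn⟩ := ih
    have hκfin := gagliardo_ne_top_of_contDiff hκ hκc
    refine ⟨ENNReal.ofReal (2 * 1 ^ 2) * C + ENNReal.ofReal (2 * M ^ 2) * gagliardo κ,
      by finiteness, fun n => ?_⟩
    have h1 : (fun x => φ x * ∏ b ∈ insert a s, (1 - κ (((n : ℝ) + 1) * (x - b)))) =
        fun x => (φ x * ∏ b ∈ s, (1 - κ (((n : ℝ) + 1) * (x - b)))) *
          (1 - κ (((n : ℝ) + 1) * (x - a))) := by
      ext x
      rw [Finset.prod_insert ha]
      ring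
    have hκcont := hκ.continuous
    rw [h1]
    refine (gagliardo_mul_le (B := M) (M := 1) (ae_of_all _ fun x => ?_) (by fun_prop)
      fun x => hρ _).trans ?_
    · rw [abs_mul, Finset.abs_prod]
      refine (mul_le_of_le_one_right (abs_nonneg _) ?_).trans (hM x)
      exact Finset.prod_le_one (fun _ _ => abs_nonneg _) fun _ _ => hρ _
    · have h2 : gagliardo (fun x => 1 - κ (((n : ℝ) + 1) * (x - a))) = gagliardo κ := by
        rw [gagliardo_comp_mul_sub (fun y => 1 - κ y) (by positivity) a, gagliardo_one_sub]
      rw [h2]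
      gcongr
      exact hCn n

/-- Points are removable for test functions: `φ` is approximated by test functions `φₙ` vanishing
near `A` such that pairings with `f φₙ` converge to the pairing with `f φ`. -/
lemma exists_testFunction_approx (A : Finset ℝ) (φ : 𝓓((⊤ : Opens ℝ), ℝ)) :
    ∃ φn : ℕ → 𝓓(puncturedLine A, ℝ), ∀ (f G : ℝ → ℝ) (B : ℝ),
      AEStronglyMeasurable f volume → (∀ᵐ x, |f x| ≤ B) → gagliardo f ≠ ⊤ → MemLp G 2 →
      Tendsto (fun n => ∫ x, G x * quarterLaplacian (fun x => f x * φn n x) x) atTop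
        (𝓝 (∫ x, G x * quarterLaplacian (fun x => f x * φ x) x)) := by
  obtain ⟨κ, hκ, hκc, hone, hzero, hκ0, hκ1⟩ := exists_smooth_cutoff
  have hφ : ContDiff ℝ ∞ φ := φ.contDiff
  have hφc : HasCompactSupport φ := φ.hasCompactSupport
  obtain ⟨M, hM⟩ := hφc.exists_bound_of_continuous hφ.continuous
  obtain ⟨C, hC, hCn⟩ := exists_gagliardo_prod_bound hφ hφc hκ hκc hκ0 hκ1 A
  set ρ : ℕ → ℝ → ℝ := fun n x => ∏ a ∈ A, (1 - κ (((n : ℝ) + 1) * (x - a))) with hρ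
  have hρ1 : ∀ n x, |ρ n x| ≤ 1 := fun n x => by
    rw [hρ, Finset.abs_prod]
    refine Finset.prod_le_one (fun _ _ => abs_nonneg _) fun a _ => ?_
    rw [abs_le]
    constructor <;> linarith [hκ0 (((n : ℝ) + 1) * (x - a)), hκ1 (((n : ℝ) + 1) * (x - a))]
  have hρs : ∀ n, ContDiff ℝ ∞ (ρ n) := fun n =>
    contDiff_prod fun a _ => contDiff_const.sub
      (hκ.comp (contDiff_const.mul (contDiff_id.sub contDiff_const)))
  have hρlim : ∀ᵐ x, ∀ᶠ n in atTop, ρ n x = 1 := by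
    have hA : ∀ᵐ x : ℝ, x ∉ (A : Set ℝ) :=
      compl_mem_ae_iff.2 (A.finite_toSet.measure_zero volume)
    filter_upwards [hA] with x hx
    have h1 : ∀ a ∈ A, ∀ᶠ n : ℕ in atTop, 1 - κ (((n : ℝ) + 1) * (x - a)) = 1 := by
      intro a ha
      have hxa : 0 < |x - a| := abs_pos.2 (sub_ne_zero.2 fun h => hx (h ▸ ha))
      have ht : Tendsto (fun n : ℕ => (n : ℝ) + 1) atTop atTop :=
        tendsto_atTop_add_const_right _ _ tendsto_natCast_atTop_atTop
      filter_upwards [(ht.atTop_mul_const hxa).eventually_ge_atTop 2] with n hn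
      rw [hzero _ (by rwa [abs_mul, abs_of_pos (by positivity : (0 : ℝ) < n + 1)]), sub_zero]
    filter_upwards [(Filter.eventually_all_finset A).2 h1] with n hn
    exact Finset.prod_eq_one hn
  have hcpt : ∀ n, HasCompactSupport (fun x => φ x * ρ n x) := fun n => hφc.mul_right
  have hsm : ∀ n, ContDiff ℝ ∞ (fun x => φ x * ρ n x) := fun n => hφ.mul (hρs n)
  -- The factor of a point of `A` is zero within distance `1 / (n + 1)` of it.
  have hsupp : ∀ n, tsupport (fun x => φ x * ρ n x) ⊆ puncturedLine A := by
    intro n x hx hxA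
    rw [← not_not (a := x ∈ tsupport _), notMem_tsupport_iff_eventuallyEq] at hx
    refine hx ?_
    have : ∀ᶠ y : ℝ in 𝓝 x, |((n : ℝ) + 1) * (y - x)| < 1 := by
      refine (Continuous.tendsto (by fun_prop) x).eventually_lt_const ?_
      simp
    filter_upwards [this] with y hy
    have h0 : ρ n y = 0 := Finset.prod_eq_zero hxA (by rw [hone _ hy.le, sub_self])
    simp [h0]
  refine ⟨fun n => ⟨fun x => φ x * ρ n x, hsm n, hcpt n, hsupp n⟩, fun f G B hf hB hfin hG => ?_⟩
  change Tendsto (fun n => ∫ x, G x * quarterLaplacian (fun x => f x * (φ x * ρ n x)) x) atTop _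
  have hmn := fun n => memHomHalf_mul hf hB hfin (hsm n) (hcpt n)
  have hm := (memHomHalf_mul hf hB hfin hφ hφc).1
  have hbn : ∀ n, ∫⁻ x, ‖quarterLaplacian (fun x => f x * (φ x * ρ n x)) x‖ₑ ^ 2 ≤
      kernelConst⁻¹ * (ENNReal.ofReal (2 * Real.pi) *
        (ENNReal.ofReal (2 * M ^ 2) * gagliardo f + ENNReal.ofReal (2 * B ^ 2) * C)) := by
    intro n
    rw [mul_comm kernelConst⁻¹, ← div_eq_mul_inv,
      ENNReal.le_div_iff_mul_le (Or.inl kernelConst_ne_zero) (Or.inl kernelConst_ne_top), mul_comm]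
    refine (hmn n).2.trans ?_
    gcongr
    refine (gagliardo_mul_le (M := M) hB (hsm n).continuous fun x => ?_).trans ?_
    · rw [abs_mul]
      exact (mul_le_of_le_one_right (abs_nonneg _) (hρ1 n x)).trans (hM x)
    · gcongr
      exact hCn n
  refine tendsto_integral_mul_of_tendsto_schwartz
    (fun n => (hmn n).1.isQuarterLaplacian.memLp) hm.isQuarterLaplacian.memLp hG ?_ hbn
    fun ψ => ?_
  · have := ENNReal.inv_ne_top.2 kernelConst_ne_zero
    finiteness
  -- Against a Schwartz `ψ` the operator moves onto `ψ`, so only `ρ n → 1` a.e. and `|ρ n| ≤ 1` are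
  -- needed.
  · have e1 := fun n => ((hmn n).1.isQuarterLaplacian.integral_eq ψ).symm
    simp only [e1, ← hm.isQuarterLaplacian.integral_eq ψ]
    refine tendsto_integral_of_dominated_convergence
      (fun x => ‖((f x * φ x : ℝ) : ℂ) * quarterLaplacianSchwartz ψ x‖)
      (fun n => ((hmn n).1.isQuarterLaplacian.integrable ψ).aestronglyMeasurable)
      (hm.isQuarterLaplacian.integrable ψ).norm (fun n => ae_of_all _ fun x => ?_) ?_
    · rw [norm_mul, norm_mul]
      refine mul_le_mul_of_nonneg_right ?_ (norm_nonneg _)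
      rw [Complex.norm_real, Complex.norm_real, ← mul_assoc, norm_mul]
      exact mul_le_of_le_one_right (norm_nonneg _) (hρ1 n x)
    · filter_upwards [hρlim] with x hx
      refine tendsto_const_nhds.congr' ?_
      filter_upwards [hx] with n hn
      rw [hn, mul_one]

end HalfHarmonic

theorem proposition2p2 {m : ℕ} (u : ℝ → EuclideanSpace ℝ (Fin m)) (A : Finset ℝ)
    (hu : HalfHarmonic.MemHomHalfSphere u)
    (hA : HalfHarmonic.IsHalfHarmonicOn u (HalfHarmonic.puncturedLine A)) :
    (∀ φ : 𝓓((⊤ : Opens ℝ), ℝ), ∀ i : Fin m,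
      HalfHarmonic.MemHomHalf (fun x => u x i * φ x)) ∧
    HalfHarmonic.IsHalfHarmonicOn u ⊤ := by
  have hmeas : ∀ i, AEStronglyMeasurable (fun x => u x i) volume := fun i =>
    (hu.memHomHalf i).isQuarterLaplacian.locallyIntegrable.aestronglyMeasurable
  have hB : ∀ i, ∀ᵐ x, |u x i| ≤ 1 := fun i => by
    filter_upwards [hu.mem_sphere] with x hx
    rw [mem_sphere_zero_iff_norm] at hx
    exact (PiLp.norm_apply_le (u x) i).trans hx.le
  have hfin : ∀ i, HalfHarmonic.gagliardo (fun x => u x i) ≠ ⊤ := fun i =>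
    (hu.memHomHalf i).isQuarterLaplacian.gagliardo_ne_top (hB i)
  refine ⟨fun φ i => (HalfHarmonic.memHomHalf_mul (hmeas i) (hB i) (hfin i) φ.contDiff
    φ.hasCompactSupport).1, fun φ i j => ?_⟩
  obtain ⟨φn, hφn⟩ := HalfHarmonic.exists_testFunction_approx A φ
  have hlim : Filter.Tendsto (fun n => HalfHarmonic.wedgeHalfLaplacian u i j (φn n)) Filter.atTop
      (nhds (HalfHarmonic.wedgeHalfLaplacian u i j φ)) :=
    (hφn _ _ 1 (hmeas i) (hB i) (hfin i) (hu.memHomHalf j).isQuarterLaplacian.memLp).sub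
      (hφn _ _ 1 (hmeas j) (hB j) (hfin j) (hu.memHomHalf i).isQuarterLaplacian.memLp)
  simp only [hA (φn _) i j] at hlim
  exact tendsto_nhds_unique hlim tendsto_const_nhds
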